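/- Let $M\subset B(H)$ be a von Neumann algebra on a Hilbert space $H$ with a cyclic and separating unit vector $\xi_0$ (so $M$ is a $\sigma$-finite $W^*$-algebra in standard form), and let $\alpha$ be an action of the circle group $\mathbf T=\{z\in\mathbb C:|z|=1\}$ on $M$ by $*$-automorphisms that is $w^*$-continuous, i.e. $z\mapsto\alpha_z(m)$ is continuous for the $w^*$-topology for every $m\in M$. Assume that the faithful normal state $\varphi(m)=\langle m\xi_0,\xi_0\rangle$ is $\alpha$-invariant, and let $U_z$ $(z\in\mathbf T)$ be the unitary operators on $H$ determined by $U_z(m\xi_0)=\alpha_z(m)\xi_0$, $m\in M$. For $n\in\mathbb Z$ put $$M_n=\{m\in M:\alpha_z(m)=z^n m\ \text{for all } z\in\mathbf T\},\qquad H_n=\{\xi\in H: U_z\xi=z^n\xi\ \text{for all } z\in\mathbf T\},$$ and let $sp(\alpha)=\{n\in\mathbb Z: M_n\neq\{0\}\}$ be the Arveson spectrum of $\alpha$. Let $H_+=\bigoplus_{n\ge 0}H_n\subset H$ (Hilbert space direct sum of the mutually orthogonal subspaces $H_n$) be the generalized Hardy space, $p_+$ the orthogonal projection of $H$ onto $H_+$,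 $\bigvee_{n\ge0}M_n$ the weak-operator closed subalgebra of $B(H)$ generated by the $M_n$, $n\ge0$, and $$M_+=p_+\Big(\bigvee_{n\ge 0}M_n\Big)\Big|_{H_+}\subset B(H_+).$$ If $sp(\alpha)$ is finite, then $M_+$ is reflexive, that is, $M_+=\mathrm{algLat}(M_+)$, where $\mathrm{algLat}(M_+)$ is the set of all $b\in B(H_+)$ with $bK\subset K$ for every closed subspace $K\subset H_+$ that is invariant under all operators in $M_+$. -/

import Mathlib

open scoped InnerProductSpace

noncomputable section

namespace PeriodicFlow

variable {H : Type*} [NormedAddCommGroup H] [InnerProductSpace ℂ H] [CompleteSpace H]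

/-- The ultraweak (σ-weak) topology on `B(H)`, which is the w*-topology given by the predual of
trace class operators: the coarsest topology for which all functionals
`a ↦ ∑ₖ ⟪ηₖ, a ζₖ⟫`, with `η`, `ζ` square summable sequences in `H`, are continuous. -/
@[reducible] def ultraweakTopology (H : Type*) [NormedAddCommGroup H] [InnerProductSpace ℂ H] :
    TopologicalSpace (H →L[ℂ] H) :=
  TopologicalSpace.induced
    (fun (a : H →L[ℂ] H) (p : lp (fun _ : ℕ => H) 2 × lp (fun _ : ℕ => H) 2) =>
      ∑' k : ℕ, ⟪p.1 k, a (p.2 k)⟫_ℂ)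
    inferInstance

/-- An action `α` of the circle group on the von Neumann algebra `M` by *-automorphisms is
w*-continuous if `z ↦ α_z(m)` is continuous for the w*-topology, for every `m ∈ M`. -/
def IsWStarContinuous {M : VonNeumannAlgebra H}
    (α : Circle →* (M.toStarSubalgebra ≃⋆ₐ[ℂ] M.toStarSubalgebra)) : Prop :=
  ∀ m : M.toStarSubalgebra,
    @Continuous Circle (H →L[ℂ] H) _ (ultraweakTopology H) (fun z => (α z m : H →L[ℂ] H))

/-- `ξ` is cyclic for `M`: the subspace `M ξ` is dense in `H`. -/
def IsCyclic (M : VonNeumannAlgebra H) (ξ : H) : Prop :=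
  Dense {η : H | ∃ m ∈ M, m ξ = η}

/-- `ξ` is separating for `M`. -/
def IsSeparating (M : VonNeumannAlgebra H) (ξ : H) : Prop :=
  ∀ m ∈ M, m ξ = 0 → m = 0

/-- The vector state `m ↦ ⟪ξ, m ξ⟫` of `M` is invariant under the action `α`. -/
def IsInvariantVectorState {M : VonNeumannAlgebra H}
    (α : Circle →* (M.toStarSubalgebra ≃⋆ₐ[ℂ] M.toStarSubalgebra)) (ξ : H) : Prop :=
  ∀ (z : Circle) (m : M.toStarSubalgebra),
    ⟪ξ, (α z m : H →L[ℂ] H) ξ⟫_ℂ = ⟪ξ, (m : H →L[ℂ] H) ξ⟫_ℂ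

/-- The spectral subspace `M_n = {m ∈ M | α_z(m) = z ^ n m for all z}`. -/
def spectralSubspace {M : VonNeumannAlgebra H}
    (α : Circle →* (M.toStarSubalgebra ≃⋆ₐ[ℂ] M.toStarSubalgebra)) (n : ℤ) :
    Submodule ℂ M.toStarSubalgebra where
  carrier := {m | ∀ z : Circle, α z m = ((z : ℂ) ^ n) • m}
  add_mem' {a b} ha hb z := by rw [map_add, ha z, hb z, smul_add]
  zero_mem' z := by rw [map_zero, smul_zero]
  smul_mem' c a ha z := by rw [map_smul, ha z, smul_comm]

/-- The Arveson spectrum `{n ∈ ℤ | M_n ≠ 0}` of the action. -/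
def arvesonSpectrum {M : VonNeumannAlgebra H}
    (α : Circle →* (M.toStarSubalgebra ≃⋆ₐ[ℂ] M.toStarSubalgebra)) : Set ℤ :=
  {n | spectralSubspace α n ≠ ⊥}

/-- The orbit map `m ↦ m ξ`. -/
def orbitMap (M : VonNeumannAlgebra H) (ξ : H) : M.toStarSubalgebra →ₗ[ℂ] H where
  toFun m := (m : H →L[ℂ] H) ξ
  map_add' _ _ := rfl
  map_smul' _ _ := rfl

/-- The map `m ↦ α_z(m) ξ`. -/
def movedOrbitMap {M : VonNeumannAlgebra H}
    (α : Circle →* (M.toStarSubalgebra ≃⋆ₐ[ℂ] M.toStarSubalgebra)) (ξ : H) (z : Circle) :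
    M.toStarSubalgebra →ₗ[ℂ] H where
  toFun m := (α z m : H →L[ℂ] H) ξ
  map_add' a b := by rw [map_add]; rfl
  map_smul' c a := by rw [map_smul]; rfl

/-- The unitary operators `U_z` with `U_z (m ξ) = α_z(m) ξ` for `m ∈ M`: the continuous extension
to `H` of the map defined by this formula on the dense subspace `M ξ`. -/
def flowUnitary {M : VonNeumannAlgebra H}
    (α : Circle →* (M.toStarSubalgebra ≃⋆ₐ[ℂ] M.toStarSubalgebra)) (ξ : H) (z : Circle) :
    H →L[ℂ] H :=
  (movedOrbitMap α ξ z).extendOfNorm (orbitMap M ξ)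

theorem norm_orbit {M : VonNeumannAlgebra H}
    {α : Circle →* (M.toStarSubalgebra ≃⋆ₐ[ℂ] M.toStarSubalgebra)} {ξ : H}
    (hinv : IsInvariantVectorState α ξ) (z : Circle) (m : M.toStarSubalgebra) :
    ‖(α z m : H →L[ℂ] H) ξ‖ = ‖(m : H →L[ℂ] H) ξ‖ := by
  have key : ∀ a : M.toStarSubalgebra,
      ⟪(a : H →L[ℂ] H) ξ, (a : H →L[ℂ] H) ξ⟫_ℂ
        = ⟪ξ, ((star a * a : M.toStarSubalgebra) : H →L[ℂ] H) ξ⟫_ℂ := by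
    intro a
    change _ = ⟪ξ, (star (a : H →L[ℂ] H)) ((a : H →L[ℂ] H) ξ)⟫_ℂ
    rw [ContinuousLinearMap.star_eq_adjoint, ContinuousLinearMap.adjoint_inner_right]
  have h : ⟪(α z m : H →L[ℂ] H) ξ, (α z m : H →L[ℂ] H) ξ⟫_ℂ
      = ⟪(m : H →L[ℂ] H) ξ, (m : H →L[ℂ] H) ξ⟫_ℂ := by
    rw [key, key, ← hinv z (star m * m), map_mul, map_star]
  rw [inner_self_eq_norm_sq_to_K, inner_self_eq_norm_sq_to_K] at h
  have h' : ‖(α z m : H →L[ℂ] H) ξ‖ ^ 2 = ‖(m : H →L[ℂ] H) ξ‖ ^ 2 := by exact_mod_cast h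
  exact (sq_eq_sq₀ (norm_nonneg _) (norm_nonneg _)).1 h'

/-- The defining property of `U_z`. -/
theorem flowUnitary_apply {M : VonNeumannAlgebra H}
    {α : Circle →* (M.toStarSubalgebra ≃⋆ₐ[ℂ] M.toStarSubalgebra)} {ξ : H}
    (hcyc : IsCyclic M ξ) (hinv : IsInvariantVectorState α ξ)
    (z : Circle) (m : M.toStarSubalgebra) :
    flowUnitary α ξ z ((m : H →L[ℂ] H) ξ) = (α z m : H →L[ℂ] H) ξ := by
  have hd : DenseRange (orbitMap M ξ) := by
    refine hcyc.mono ?_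
    rintro η ⟨a, ha, rfl⟩
    exact ⟨⟨a, ha⟩, rfl⟩
  exact LinearMap.extendOfNorm_eq
    (f := movedOrbitMap α ξ z) hd
    ⟨1, fun a => by rw [one_mul]; exact (norm_orbit hinv z a).le⟩ m

/-- The subspace `H_n = {η ∈ H | U_z η = z ^ n η for all z}`. -/
def hardyComponent {M : VonNeumannAlgebra H}
    (α : Circle →* (M.toStarSubalgebra ≃⋆ₐ[ℂ] M.toStarSubalgebra)) (ξ : H) (n : ℤ) :
    Submodule ℂ H where
  carrier := {η | ∀ z : Circle, flowUnitary α ξ z η = ((z : ℂ) ^ n) • η}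
  add_mem' {a b} ha hb z := by rw [map_add, ha z, hb z, smul_add]
  zero_mem' z := by rw [map_zero, smul_zero]
  smul_mem' c a ha z := by rw [map_smul, ha z, smul_comm]

/-- The generalized Hardy space `H₊`: the closed linear span of the (mutually orthogonal)
subspaces `H_n`, `n ≥ 0`. -/
def hardySpace {M : VonNeumannAlgebra H}
    (α : Circle →* (M.toStarSubalgebra ≃⋆ₐ[ℂ] M.toStarSubalgebra)) (ξ : H) : Submodule ℂ H :=
  (⨆ n : ℕ, hardyComponent α ξ (n : ℤ)).topologicalClosure

instance hardySpace_completeSpace {M : VonNeumannAlgebra H}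
    (α : Circle →* (M.toStarSubalgebra ≃⋆ₐ[ℂ] M.toStarSubalgebra)) (ξ : H) :
    CompleteSpace (hardySpace α ξ) :=
  inferInstanceAs (CompleteSpace (Submodule.topologicalClosure _))

/-- A set of operators is closed in the weak operator topology. -/
def IsWOTClosed (A : Set (H →L[ℂ] H)) : Prop :=
  IsClosed ((fun b : H →WOT[ℂ] H => b.toCLM) ⁻¹' A)

/-- The weak-operator closed algebra `⋁_{n ≥ 0} M_n` generated by the `M_n`, `n ≥ 0` (these
contain the identity operator): the smallest weak-operator closed subalgebra of `B(H)` that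
contains all of them. -/
def analyticJoin {M : VonNeumannAlgebra H}
    (α : Circle →* (M.toStarSubalgebra ≃⋆ₐ[ℂ] M.toStarSubalgebra)) :
    Subalgebra ℂ (H →L[ℂ] H) :=
  sInf {B | IsWOTClosed (B : Set (H →L[ℂ] H)) ∧
    ∀ n : ℕ, ∀ m ∈ spectralSubspace α (n : ℤ), (m : H →L[ℂ] H) ∈ B}

/-- The analytic elements `M₊ = p₊ (⋁_{n ≥ 0} M_n)|_{H₊} ⊆ B(H₊)`, where `p₊` is the orthogonal
projection of `H` onto `H₊`. -/
def analyticAlgebra {M : VonNeumannAlgebra H}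
    (α : Circle →* (M.toStarSubalgebra ≃⋆ₐ[ℂ] M.toStarSubalgebra)) (ξ : H) :
    Set (hardySpace α ξ →L[ℂ] hardySpace α ξ) :=
  (fun a : H →L[ℂ] H =>
    (hardySpace α ξ).orthogonalProjectionOnto ∘L a ∘L (hardySpace α ξ).subtypeL) ''
      (analyticJoin α : Set (H →L[ℂ] H))

/-- `Lat A`: the closed subspaces invariant under all operators in `A`. -/
def lat {X : Type*} [NormedAddCommGroup X] [InnerProductSpace ℂ X] (A : Set (X →L[ℂ] X)) :
    Set (Submodule ℂ X) :=
  {K | IsClosed (K : Set X) ∧ ∀ a ∈ A, ∀ x ∈ K, a x ∈ K}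

/-- `algLat A`: the operators that leave every subspace in `Lat A` invariant. -/
def algLat {X : Type*} [NormedAddCommGroup X] [InnerProductSpace ℂ X] (A : Set (X →L[ℂ] X)) :
    Set (X →L[ℂ] X) :=
  {b | ∀ K ∈ lat A, ∀ x ∈ K, b x ∈ K}

/-- `A` is reflexive: `A = algLat A`. -/
def IsReflexive {X : Type*} [NormedAddCommGroup X] [InnerProductSpace ℂ X]
    (A : Set (X →L[ℂ] X)) : Prop :=
  A = algLat A

end PeriodicFlow

end

/-! Let `b` lie in `algLat` of M₊ and let `B` be its extension by zero to `H`. If `c` in the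
commutant M' maps H₊ into itself, the kernel of `c` in H₊ is a closed subspace invariant under M₊,
hence under `B`. Nothing else about `b` is used: feeding well chosen `c` into this remark makes `B`
commute, on H₊, with every homogeneous element of M' of degree ≥ 0.

For an idempotent `p`, the kernels of `p` and `1 - p` force commutation. For `x = q x p` with
orthogonal idempotents `p`, `q`, the kernel of `q - x` contains the graph of `x` over the range of
`p` in H₊, and invariance of this graph gives commutation. In degree 0, self-adjoint elements are
reached through the projections of their bicommutant. In degree n > 0, finiteness of the spectrum
makes `x` nilpotent, and the closed ranges of its powers split `x` into pieces of the form `q x p`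
(`commutes_of_isNilpotent`).

Elements `x` of negative degree need not commute with `B`, but |x| has degree 0, so ‖x B ξ‖ ≤ ‖B‖ ‖x
ξ‖ (`norm_apply_le`). As every operator is a sum of boundedly many homogeneous components, x ξ ↦ x B
ξ is bounded on the dense subspace M'ξ. Its extension `a` commutes with M', so it lies in M, and it
agrees with `B` on H₊ because vectors x ξ with `x` of degree n ≥ 0 are dense in H_n
(`exists_mem_eqOn`). Finally a ξ ∈ H₊ kills the components of `a` of negative degree, since ξ is
separating (`mem_analyticJoin_of_apply_mem`). -/

noncomputable section

namespace PeriodicFlow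

open MeasureTheory AddCircle

/-! ### Fourier coefficients of vector valued functions on the circle -/

section CircleCoefficients

variable {E F : Type*} [NormedAddCommGroup E] [NormedSpace ℂ E]
  [NormedAddCommGroup F] [NormedSpace ℂ F]

/-- The `n`-th Fourier coefficient of a vector valued function on the circle group. -/
def circleCoeff (f : Circle → E) (n : ℤ) : E :=
  fourierCoeff (fun t : UnitAddCircle => f (toCircle t)) n

theorem integrable_fourier_smul {f : Circle → E} (hf : Continuous f) (n : ℤ) :
    Integrable (fun t : UnitAddCircle => fourier (-n) t • f (toCircle t)) haarAddCircle := by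
  have hc : Continuous (fun t : UnitAddCircle => fourier (-n) t • f (toCircle t)) :=
    (map_continuous _).smul (hf.comp continuous_toCircle)
  exact hc.integrable_of_hasCompactSupport (HasCompactSupport.of_compactSpace _)

theorem circleCoeff_add {f g : Circle → E} (hf : Continuous f) (hg : Continuous g) (n : ℤ) :
    circleCoeff (fun z => f z + g z) n = circleCoeff f n + circleCoeff g n := by
  simp only [circleCoeff, fourierCoeff, smul_add]
  exact integral_add (integrable_fourier_smul hf n) (integrable_fourier_smul hg n)

theorem circleCoeff_smul (c : ℂ) (f : Circle → E) (n : ℤ) :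
    circleCoeff (fun z => c • f z) n = c • circleCoeff f n :=
  fourierCoeff.const_smul _ c n

theorem norm_circleCoeff_le {f : Circle → E} {C : ℝ} (hf : ∀ z, ‖f z‖ ≤ C) (n : ℤ) :
    ‖circleCoeff f n‖ ≤ C := by
  have h := norm_integral_le_of_norm_le_const (μ := haarAddCircle (T := (1 : ℝ)))
    (f := fun t : UnitAddCircle => fourier (-n) t • f (toCircle t)) (C := C)
    (Filter.Eventually.of_forall fun t => by
      rw [norm_smul, fourier_apply, Circle.norm_coe, one_mul]; exact hf _)
  simpa [circleCoeff, fourierCoeff] using h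

theorem map_circleCoeff [CompleteSpace E] [CompleteSpace F] (L : E →L[ℂ] F) {f : Circle → E}
    (hf : Continuous f) (n : ℤ) :
    L (circleCoeff f n) = circleCoeff (fun z => L (f z)) n := by
  simp only [circleCoeff, fourierCoeff]
  rw [← L.integral_comp_comm (integrable_fourier_smul hf n)]
  simp only [map_smul]

theorem circleCoeff_zpow_smul (f : Circle → E) (m n : ℤ) :
    circleCoeff (fun z => ((z : ℂ) ^ m) • f z) n = circleCoeff f (n - m) := by
  simp only [circleCoeff, fourierCoeff]
  congr 1
  funext t
  have h : -(n - m) = -n + m := by ring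
  rw [smul_smul, h, fourier_add, fourier_apply (n := m), toCircle_zsmul, Circle.coe_zpow]

/-- Invariance of Haar measure under translation. This is what makes Fourier coefficients of orbits
weight vectors. -/
theorem circleCoeff_mul_left (f : Circle → E) (w : Circle) (n : ℤ) :
    circleCoeff (fun z => f (w * z)) n = ((w : ℂ) ^ n) • circleCoeff f n := by
  obtain ⟨s, rfl⟩ : ∃ s : UnitAddCircle, toCircle s = w := by
    obtain ⟨s, hs⟩ := (homeomorphCircle (T := (1 : ℝ)) one_ne_zero).surjective w
    exact ⟨s, by rw [← hs, homeomorphCircle_apply]⟩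
  simp only [circleCoeff, fourierCoeff]
  rw [← integral_add_left_eq_self (μ := haarAddCircle)
    (fun t : UnitAddCircle => fourier (-n) t • f (toCircle t)) s, ← integral_smul]
  congr 1
  funext t
  have h : fourier (-n) (s + t) = fourier (-n) s * (fourier (-n) t : ℂ) := by
    simp only [fourier_apply, smul_add, toCircle_add, Circle.coe_mul]
  have h2 : ((toCircle s : Circle) : ℂ) ^ n * fourier (-n) s = 1 := by
    rw [fourier_apply, toCircle_zsmul, Circle.coe_zpow, ← zpow_add₀ (Circle.coe_ne_zero _)]
    simp
  rw [toCircle_add, h, smul_smul, ← mul_assoc, h2, one_mul]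

theorem circleCoeff_zpow_self [CompleteSpace E] (v : E) (n : ℤ) :
    circleCoeff (fun z => ((z : ℂ) ^ n) • v) n = v := by
  rw [circleCoeff_zpow_smul, sub_self]
  simp [circleCoeff, fourierCoeff]

theorem circleCoeff_mem [CompleteSpace E] {K : Submodule ℂ E} (hK : IsClosed (K : Set E))
    {f : Circle → E} (hf : Continuous f) (hfK : ∀ z, f z ∈ K) (n : ℤ) : circleCoeff f n ∈ K := by
  have hconv : Convex ℝ (K : Set E) := (K.restrictScalars ℝ).convex
  exact hconv.integral_mem hK (Filter.Eventually.of_forall fun t => K.smul_mem _ (hfK _))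
    (integrable_fourier_smul hf n)

/-- A continuous function with only finitely many non-zero Fourier coefficients is the sum of its
Fourier series (evaluated here at the neutral element). -/
theorem eq_sum_circleCoeff {H : Type*} [NormedAddCommGroup H] [InnerProductSpace ℂ H]
    [CompleteSpace H] {f : Circle → H} (hf : Continuous f) (S : Finset ℤ)
    (hS : ∀ n ∉ S, circleCoeff f n = 0) : f 1 = ∑ n ∈ S, circleCoeff f n := by
  -- Pairing with a fixed vector reduces the claim to scalar Fourier series, where summable
  -- coefficients give pointwise convergence.
  refine ext_inner_left ℂ fun v => ?_
  let g : C(UnitAddCircle, ℂ) :=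
    ⟨fun t => ⟪v, f (toCircle t)⟫_ℂ, continuous_const.inner (hf.comp continuous_toCircle)⟩
  have hg : ∀ n, fourierCoeff g n = ⟪v, circleCoeff f n⟫_ℂ := fun n =>
    (map_circleCoeff (innerSL ℂ v) hf n).symm
  have h0 : ∀ n ∉ S, fourierCoeff g n = 0 := fun n hn => by rw [hg, hS n hn, inner_zero_right]
  have h1 := has_pointwise_sum_fourier_series_of_summable
    (summable_of_ne_finset_zero (s := S) h0) 0
  have h2 : HasSum (fun i => fourierCoeff g i • fourier i (0 : UnitAddCircle))
      (∑ n ∈ S, fourierCoeff g n • fourier n (0 : UnitAddCircle)) :=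
    hasSum_sum_of_ne_finset_zero fun n hn => by rw [h0 n hn, zero_smul]
  have h3 := h1.unique h2
  simp only [fourier_eval_zero, smul_eq_mul, mul_one, hg, ← inner_sum] at h3
  rw [← h3]
  simp [g]

end CircleCoefficients

/-! ### Commutation with self-adjoint operators, tested on projections -/

section Symmetries

variable {H : Type*} [NormedAddCommGroup H] [InnerProductSpace ℂ H]

theorem norm_add_sq_of_mem_orthogonal {V : Submodule ℂ H} {v w : H} (hv : v ∈ V) (hw : w ∈ Vᗮ) :
    ‖v + w‖ ^ 2 = ‖v‖ ^ 2 + ‖w‖ ^ 2 := by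
  have := norm_add_sq_eq_norm_sq_add_norm_sq_of_inner_eq_zero (𝕜 := ℂ) v w
    (Submodule.inner_right_of_mem_orthogonal hv hw)
  simpa only [sq] using this

variable [CompleteSpace H]

theorem apply_mem_orthogonal {c : H →L[ℂ] H} {V : Submodule ℂ H}
    (hc : ∀ v ∈ V, star c v ∈ V) {w : H} (hw : w ∈ Vᗮ) : c w ∈ Vᗮ := by
  rw [Submodule.mem_orthogonal] at hw ⊢
  intro u hu
  rw [← ContinuousLinearMap.adjoint_inner_left, ← ContinuousLinearMap.star_eq_adjoint]
  exact hw _ (hc u hu)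

theorem commute_starProjection {c : H →L[ℂ] H} {V : Submodule ℂ H} [V.HasOrthogonalProjection]
    (h1 : ∀ v ∈ V, c v ∈ V) (h2 : ∀ v ∈ V, star c v ∈ V) : Commute c V.starProjection := by
  ext v
  have h : V.starProjection (c v) = c (V.starProjection v) := by
    refine (Submodule.eq_starProjection_of_mem_orthogonal (h1 _ (V.starProjection_apply_mem v)) ?_)
    rw [← map_sub]
    exact apply_mem_orthogonal h2 (V.sub_starProjection_mem_orthogonal v)
  exact h.symm

/-- Every self-adjoint contraction `y` is at distance at most one half from `s / 2`, for some
symmetry `s = 2 e - 1` in the bicommutant of `y`. -/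
theorem exists_projection_norm_le {y : H →L[ℂ] H} (hy : IsSelfAdjoint y) (hy1 : ‖y‖ ≤ 1) :
    ∃ V : Submodule ℂ H, ∃ _ : V.HasOrthogonalProjection,
      (∀ c, Commute c y → Commute c V.starProjection) ∧
      ‖(2 : ℂ) • y - ((2 : ℂ) • V.starProjection - 1)‖ ≤ 1 := by
  set yp : H →L[ℂ] H := cfc (fun t : ℝ => max t 0) y with hyp
  set ym : H →L[ℂ] H := cfc (fun t : ℝ => max (-t) 0) y with hym
  have hspec : ∀ t ∈ spectrum ℝ y, |t| ≤ 1 := fun t ht => by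
    have h := spectrum.norm_le_norm_mul_of_mem ht
    have h1 : ‖(1 : H →L[ℂ] H)‖ ≤ 1 := ContinuousLinearMap.norm_id_le
    rw [Real.norm_eq_abs] at h
    exact h.trans (mul_le_one₀ hy1 (norm_nonneg _) h1)
  have hsa_m : IsSelfAdjoint ym := cfc_predicate _ _
  have hsa_p : IsSelfAdjoint yp := cfc_predicate _ _
  have hsub : y = yp - ym := by
    rw [hyp, hym, ← cfc_sub (fun t : ℝ => max t 0) (fun t : ℝ => max (-t) 0) y]
    conv_lhs => rw [← cfc_id ℝ y]
    refine cfc_congr fun t _ => ?_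
    rcases le_total t 0 with h | h <;> simp [h]
  have hmp : ym * yp = 0 := by
    rw [hyp, hym, ← cfc_mul (fun t : ℝ => max (-t) 0) (fun t : ℝ => max t 0) y]
    rw [← cfc_const_zero (R := ℝ) y]
    refine cfc_congr fun t _ => ?_
    rcases le_total t 0 with h | h <;> simp [h]
  have hnorm : ∀ f : ℝ → ℝ, Continuous f → (∀ t, |t| ≤ 1 → 0 ≤ f t ∧ f t ≤ 1) → ∀ v : H,
      ‖v - (2 : ℂ) • (cfc f y : H →L[ℂ] H) v‖ ≤ ‖v‖ := by
    intro f hf h01 v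
    have h1 : ‖cfc (fun t : ℝ => 1 - 2 * f t) y‖ ≤ 1 := by
      refine norm_cfc_le zero_le_one fun t ht => ?_
      have := h01 t (hspec t ht)
      rw [Real.norm_eq_abs, abs_le]
      constructor <;> linarith [this.1, this.2]
    have h2 : cfc (fun t : ℝ => 1 - 2 * f t) y = 1 - (2 : ℝ) • cfc f y := by
      rw [cfc_sub (fun _ : ℝ => (1 : ℝ)) (fun t => 2 * f t) y, cfc_const_one ℝ y,
        cfc_const_mul (2 : ℝ) f y]
    have h3 := (cfc (fun t : ℝ => 1 - 2 * f t) y).le_of_opNorm_le h1 v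
    rw [h2, one_mul] at h3
    rwa [sub_apply, one_apply_eq_self, smul_apply, two_smul ℝ, ← two_smul ℂ] at h3
  have hnp : ∀ v : H, ‖v - (2 : ℂ) • yp v‖ ≤ ‖v‖ := hnorm _ (by fun_prop) fun t ht =>
    ⟨le_max_right _ _, max_le (abs_le.1 ht).2 zero_le_one⟩
  have hnm : ∀ v : H, ‖v - (2 : ℂ) • ym v‖ ≤ ‖v‖ := hnorm _ (by fun_prop) fun t ht =>
    ⟨le_max_right _ _, max_le (by linarith [(abs_le.1 ht).1]) zero_le_one⟩
  -- With `V` the kernel of the negative part, `y` acts as `yp` on `V` and as `-ym` on its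
  -- complement. Hence 2y - s is -(1 - 2 `yp`) on `V` and 1 - 2 `ym` on the complement; both are
  -- contractions because `yp` and `ym` lie between 0 and 1.
  let V : Submodule ℂ H := ym.ker
  have hV : ∀ v, v ∈ V ↔ ym v = 0 := fun v => LinearMap.mem_ker
  have hcl : IsClosed (V : Set H) := ym.isClosed_ker
  have : CompleteSpace V := hcl.completeSpace_coe
  have hpV : ∀ v, yp v ∈ V := fun v => (hV _).2 (by
    have := congrArg (fun T : H →L[ℂ] H => T v) hmp
    simpa using this)
  refine ⟨V, inferInstance, fun c hc => ?_, ?_⟩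
  · have key : ∀ d : H →L[ℂ] H, Commute d y → ∀ v ∈ V, d v ∈ V := by
      intro d hd v hv
      have h := (Commute.cfc_real hd.symm (fun t : ℝ => max (-t) 0)).eq
      have h2 := congrArg (fun T : H →L[ℂ] H => T v) h
      simp only [mul_apply_eq_comp, ← hym] at h2
      rw [hV] at hv ⊢
      rw [h2, hv, map_zero]
    refine commute_starProjection (key c hc) (key (star c) ?_)
    have := hc.star_star
    rwa [hy.star_eq] at this
  · refine ContinuousLinearMap.opNorm_le_bound _ zero_le_one fun v => ?_
    rw [one_mul]
    set v1 := V.starProjection v with hv1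
    set v2 := v - v1 with hv2
    have hv1m : v1 ∈ V := V.starProjection_apply_mem v
    have hv2m : v2 ∈ Vᗮ := V.sub_starProjection_mem_orthogonal v
    have hyp2 : yp v2 = 0 := by
      refine ext_inner_left ℂ fun u => ?_
      rw [inner_zero_right, ← ContinuousLinearMap.adjoint_inner_left,
        ← ContinuousLinearMap.star_eq_adjoint, hsa_p.star_eq]
      exact (Submodule.mem_orthogonal _ _).1 hv2m _ (hpV u)
    have hym1 : ym v1 = 0 := (hV _).1 hv1m
    have hvv : v = v1 + v2 := by rw [hv2]; abel
    have hw2 : v2 - (2 : ℂ) • ym v2 ∈ Vᗮ := by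
      refine Submodule.sub_mem _ hv2m (Submodule.smul_mem _ _ (apply_mem_orthogonal ?_ hv2m))
      intro u hu
      rw [hsa_m.star_eq, (hV u).1 hu]
      exact V.zero_mem
    have hw1 : -(v1 - (2 : ℂ) • yp v1) ∈ V :=
      V.neg_mem (V.sub_mem hv1m (V.smul_mem _ (hpV v1)))
    have heq : ((2 : ℂ) • y - ((2 : ℂ) • V.starProjection - 1)) v
        = -(v1 - (2 : ℂ) • yp v1) + (v2 - (2 : ℂ) • ym v2) := by
      have : y v = yp v1 - ym v2 := by
        rw [hsub]
        simp only [sub_apply]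
        rw [hvv, map_add, map_add, hyp2, hym1]
        abel
      simp only [sub_apply, smul_apply,
        one_apply_eq_self, this, ← hv1]
      nth_rewrite 1 [hvv]
      simp only [smul_sub, two_smul]
      abel
    rw [heq]
    have e1 := norm_add_sq_of_mem_orthogonal hw1 hw2
    have e2 := norm_add_sq_of_mem_orthogonal hv1m hv2m
    rw [← hvv] at e2
    rw [norm_neg] at e1
    refine (sq_le_sq₀ (norm_nonneg _) (norm_nonneg _)).1 ?_
    rw [e1, e2]
    gcongr
    · exact hnp v1
    · exact hnm v2

/-- Dyadic expansion of `y` into symmetries. The remainder y' = 2y - s is again a self-adjoint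
contraction in the bicommutant of `y`, and [b, y'] = 2 [b, y] because `b` commutes with s. Each
round therefore halves the trivial bound 2‖b‖. -/
theorem norm_commutator_le (b : H →L[ℂ] H) (n : ℕ) :
    ∀ {y : H →L[ℂ] H}, IsSelfAdjoint y → ‖y‖ ≤ 1 →
    (∀ V : Submodule ℂ H, ∀ _ : V.HasOrthogonalProjection,
      (∀ c, Commute c y → Commute c V.starProjection) → Commute b V.starProjection) →
    ‖b * y - y * b‖ ≤ 2 * ‖b‖ * (1 / 2) ^ n := by
  induction n with
  | zero =>
    intro y _ hy1 _
    have h1 : ‖b * y‖ ≤ ‖b‖ * 1 := (norm_mul_le b y).trans (by gcongr)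
    have h2 : ‖y * b‖ ≤ 1 * ‖b‖ := (norm_mul_le y b).trans (by gcongr)
    have := norm_sub_le (b * y) (y * b)
    rw [pow_zero]
    linarith
  | succ n ih =>
    intro y hy hy1 hb
    obtain ⟨V, hVp, hV, hle⟩ := exists_projection_norm_le hy hy1
    set y' : H →L[ℂ] H := (2 : ℂ) • y - ((2 : ℂ) • V.starProjection - 1) with hy'
    have hcomm : ∀ c, Commute c y → Commute c y' := fun c hc =>
      (hc.smul_right _).sub_right (((hV c hc).smul_right _).sub_right (Commute.one_right c))
    have hsa : IsSelfAdjoint y' := by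
      have h2 : IsSelfAdjoint (2 : ℂ) := by simp
      have hP : IsSelfAdjoint V.starProjection := isSelfAdjoint_starProjection V
      exact (h2.smul hy).sub ((h2.smul hP).sub (IsSelfAdjoint.one _))
    have h := ih hsa hle fun W hW hWc => hb W hW fun c hc => hWc c (hcomm c hc)
    have hbV := (hb V hVp hV).eq
    have heq : b * y' - y' * b = (2 : ℂ) • (b * y - y * b) := by
      rw [hy']
      simp only [mul_sub, sub_mul, mul_smul_comm, smul_mul_assoc, hbV, mul_one, one_mul, smul_sub]
      abel
    rw [heq, norm_smul, Complex.norm_ofNat] at h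
    rw [pow_succ]
    linarith

/-- An operator commutes with the self-adjoint operator `y` as soon as it commutes with all
projections of the bicommutant of `y`. -/
theorem commute_of_commute_projections {b y : H →L[ℂ] H} (hy : IsSelfAdjoint y)
    (hb : ∀ V : Submodule ℂ H, ∀ _ : V.HasOrthogonalProjection,
      (∀ c, Commute c y → Commute c V.starProjection) → Commute b V.starProjection) :
    Commute b y := by
  have key : ∀ x : H →L[ℂ] H, IsSelfAdjoint x → ‖x‖ ≤ 1 →
      (∀ V : Submodule ℂ H, ∀ _ : V.HasOrthogonalProjection,
      (∀ c, Commute c x → Commute c V.starProjection) → Commute b V.starProjection) →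
      Commute b x := by
    intro x hx hx1 hbx
    have h0 : ‖b * x - x * b‖ ≤ 0 := by
      refine ge_of_tendsto' (x := Filter.atTop) ?_ fun n => norm_commutator_le b n hx hx1 hbx
      have := (tendsto_pow_atTop_nhds_zero_of_lt_one (r := (1 / 2 : ℝ)) (by norm_num)
        (by norm_num)).const_mul (2 * ‖b‖)
      simpa using this
    exact sub_eq_zero.1 (norm_le_zero_iff.1 h0)
  -- Rescaling to a contraction; the added 1 keeps the factor positive when `y = 0`.
  set r : ℝ := ‖y‖ + 1 with hr
  have hr0 : 0 < r := by positivity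
  have hrc : (r : ℂ) ≠ 0 := by exact_mod_cast hr0.ne'
  have hback : ∀ c, Commute c (((r : ℂ)⁻¹) • y) → Commute c y := fun c hc => by
    have := hc.smul_right (r : ℂ)
    rwa [smul_smul, mul_inv_cancel₀ hrc, one_smul] at this
  refine hback b (key _ ?_ ?_ fun V hV hVc => hb V hV fun c hc => hVc c (hc.smul_right _))
  · have : IsSelfAdjoint ((r : ℂ)⁻¹) := by simp [isSelfAdjoint_iff]
    exact this.smul hy
  · rw [norm_smul, norm_inv, Complex.norm_real, Real.norm_eq_abs, abs_of_pos hr0,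
      inv_mul_le_iff₀ hr0]
    linarith

end Symmetries

/-! ### Weights and homogeneous operators for circle representations -/

section CircleRepresentations

variable {H : Type*} [NormedAddCommGroup H] [InnerProductSpace ℂ H]

/-- `U` is a strongly continuous unitary representation of the circle group. -/
structure IsUnitaryRep (U : Circle → H →L[ℂ] H) : Prop where
  map_one : U 1 = 1
  map_mul : ∀ z w, U (z * w) = U z * U w
  norm_map : ∀ z ξ, ‖U z ξ‖ = ‖ξ‖
  continuous : ∀ ξ, Continuous fun z => U z ξ

/-- The subspace of vectors of weight `n`. -/
def weightSpace (U : Circle → H →L[ℂ] H) (n : ℤ) : Submodule ℂ H where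
  carrier := {η | ∀ z : Circle, U z η = ((z : ℂ) ^ n) • η}
  add_mem' {a b} ha hb z := by rw [map_add, ha z, hb z, smul_add]
  zero_mem' z := by rw [map_zero, smul_zero]
  smul_mem' c a ha z := by rw [map_smul, ha z, smul_comm]

/-- The closed span of the vectors of non-negative weight. -/
def posSpace (U : Circle → H →L[ℂ] H) : Submodule ℂ H :=
  (⨆ n : ℕ, weightSpace U (n : ℤ)).topologicalClosure

/-- The operator `T` raises weights by `n`. -/
def IsHomogeneous (U : Circle → H →L[ℂ] H) (n : ℤ) (T : H →L[ℂ] H) : Prop :=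
  ∀ z, U z * T = ((z : ℂ) ^ n) • (T * U z)

variable {U : Circle → H →L[ℂ] H}

theorem IsHomogeneous.apply {n : ℤ} {T : H →L[ℂ] H} (hT : IsHomogeneous U n T) (z : Circle)
    (v : H) : U z (T v) = ((z : ℂ) ^ n) • T (U z v) :=
  congrArg (fun S : H →L[ℂ] H => S v) (hT z)

theorem IsHomogeneous.mul {m n : ℤ} {S T : H →L[ℂ] H} (hS : IsHomogeneous U m S)
    (hT : IsHomogeneous U n T) : IsHomogeneous U (m + n) (S * T) := by
  intro z
  ext v
  simp only [mul_apply_eq_comp, smul_apply]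
  rw [hS.apply, hT.apply, map_smul, smul_smul, zpow_add₀ (Circle.coe_ne_zero z)]

theorem IsHomogeneous.pow {n : ℤ} {T : H →L[ℂ] H} (hT : IsHomogeneous U n T) (k : ℕ) :
    IsHomogeneous U (k * n) (T ^ k) := by
  induction k with
  | zero => intro z; simp
  | succ k ih =>
    rw [pow_succ, Nat.cast_succ, add_mul, one_mul]
    exact ih.mul hT

theorem isHomogeneous_zero_iff {T : H →L[ℂ] H} :
    IsHomogeneous U 0 T ↔ ∀ z, Commute (U z) T := by
  simp [IsHomogeneous, Commute, SemiconjBy]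

theorem IsHomogeneous.mem_weightSpace {n k : ℤ} {T : H →L[ℂ] H} (hT : IsHomogeneous U n T)
    {v : H} (hv : v ∈ weightSpace U k) : T v ∈ weightSpace U (k + n) := by
  intro z
  rw [hT.apply, hv z, map_smul, smul_smul, ← zpow_add₀ (Circle.coe_ne_zero z), add_comm]

theorem IsHomogeneous.mem_posSpace {n : ℤ} (hn : 0 ≤ n) {T : H →L[ℂ] H}
    (hT : IsHomogeneous U n T) {v : H} (hv : v ∈ posSpace U) : T v ∈ posSpace U := by
  have h1 : (⨆ k : ℕ, weightSpace U (k : ℤ)) ≤ (posSpace U).comap (T : H →ₗ[ℂ] H) := by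
    refine iSup_le fun k w hw => ?_
    obtain ⟨m, rfl⟩ := Int.eq_ofNat_of_zero_le hn
    refine Submodule.le_topologicalClosure _
      ((le_iSup (fun k : ℕ => weightSpace U (k : ℤ)) (k + m)) ?_)
    have := hT.mem_weightSpace hw
    exact_mod_cast this
  have h2 : IsClosed (((posSpace U).comap (T : H →ₗ[ℂ] H) : Submodule ℂ H) : Set H) :=
    (Submodule.isClosed_topologicalClosure _).preimage T.continuous
  exact Submodule.topologicalClosure_minimal _ h1 h2 hv

theorem weightSpace_le_posSpace {n : ℤ} (hn : 0 ≤ n) : weightSpace U n ≤ posSpace U := by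
  obtain ⟨m, rfl⟩ := Int.eq_ofNat_of_zero_le hn
  exact (le_iSup (fun k : ℕ => weightSpace U (k : ℤ)) m).trans
    (Submodule.le_topologicalClosure _)

theorem isClosed_posSpace : IsClosed (posSpace U : Set H) :=
  Submodule.isClosed_topologicalClosure _

theorem exists_circle_zpow_ne_one {n : ℤ} (hn : n ≠ 0) : ∃ z : Circle, (z : ℂ) ^ n ≠ 1 := by
  refine ⟨Circle.exp (Real.pi / n), ?_⟩
  have hn' : (n : ℂ) ≠ 0 := by exact_mod_cast hn
  have h : ((Circle.exp (Real.pi / n) : Circle) : ℂ) ^ n = -1 := by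
    rw [Circle.coe_exp, ← Complex.exp_int_mul, ← Complex.exp_pi_mul_I]
    congr 1
    push_cast
    field_simp
  rw [h]
  norm_num

namespace IsUnitaryRep

theorem apply_apply (hU : IsUnitaryRep U) (z w : Circle) (v : H) : U z (U w v) = U (z * w) v := by
  rw [hU.map_mul]; rfl

theorem apply_inv_apply (hU : IsUnitaryRep U) (z : Circle) (v : H) : U z (U z⁻¹ v) = v := by
  rw [hU.apply_apply, mul_inv_cancel, hU.map_one]; rfl

theorem inner_map_map (hU : IsUnitaryRep U) (z : Circle) (v w : H) :
    ⟪U z v, U z w⟫_ℂ = ⟪v, w⟫_ℂ :=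
  LinearIsometry.inner_map_map ⟨(U z : H →ₗ[ℂ] H), hU.norm_map z⟩ v w

theorem isHomogeneous_zero (hU : IsUnitaryRep U) (w : Circle) : IsHomogeneous U 0 (U w) :=
  isHomogeneous_zero_iff.2 fun z => by
    rw [commute_iff_eq, ← hU.map_mul, mul_comm, hU.map_mul]

/-- Strong continuity upgrades to joint continuity because the `U z` are isometric. It makes the
integrand of `opCoeff` continuous on each vector. -/
theorem continuous_apply (hU : IsUnitaryRep U) {f : Circle → H} (hf : Continuous f) :
    Continuous fun z => U z (f z) := by
  rw [continuous_iff_continuousAt]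
  intro w
  have h1 : Filter.Tendsto (fun z => U z (f w)) (nhds w) (nhds (U w (f w))) :=
    (hU.continuous (f w)).tendsto w
  have h2 : Filter.Tendsto (fun z => U z (f z - f w)) (nhds w) (nhds 0) := by
    rw [tendsto_zero_iff_norm_tendsto_zero]
    simp only [hU.norm_map]
    have := ((hf.tendsto w).sub_const (f w)).norm
    simpa using this
  have h3 := h1.add h2
  simp only [map_sub, add_sub_cancel, add_zero] at h3
  exact h3

theorem inner_eq_zero (hU : IsUnitaryRep U) {m n : ℤ} (hmn : m ≠ n) {v w : H}
    (hv : v ∈ weightSpace U m) (hw : w ∈ weightSpace U n) : ⟪v, w⟫_ℂ = 0 := by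
  obtain ⟨z, hz⟩ := exists_circle_zpow_ne_one (sub_ne_zero.2 hmn.symm)
  have h := hU.inner_map_map z v w
  rw [hv z, hw z, inner_smul_left, inner_smul_right, ← mul_assoc, map_zpow₀,
    ← Circle.coe_inv_eq_conj, Circle.coe_inv, inv_zpow', ← zpow_add₀ (Circle.coe_ne_zero z)] at h
  have h2 : -m + n = n - m := by ring
  rw [h2] at h
  by_contra h0
  exact hz (mul_right_cancel₀ h0 (by rw [h, one_mul]))

theorem eq_zero_of_mem_posSpace (hU : IsUnitaryRep U) {n : ℤ} (hn : n < 0) {v : H}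
    (hv : v ∈ weightSpace U n) (hv' : v ∈ posSpace U) : v = 0 := by
  have h1 : (⨆ k : ℕ, weightSpace U (k : ℤ)) ≤ (ℂ ∙ v)ᗮ := by
    refine iSup_le fun k w hw => ?_
    rw [Submodule.mem_orthogonal_singleton_iff_inner_right]
    exact hU.inner_eq_zero (by omega) hv hw
  have h2 := Submodule.topologicalClosure_minimal _ h1 (Submodule.isClosed_orthogonal _) hv'
  rw [Submodule.mem_orthogonal_singleton_iff_inner_right] at h2
  exact inner_self_eq_zero.1 h2

theorem continuous_conj (hU : IsUnitaryRep U) (T : H →L[ℂ] H) (v : H) :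
    Continuous fun z => U z (T (U z⁻¹ v)) :=
  hU.continuous_apply (T.continuous.comp ((hU.continuous v).comp continuous_inv))

/-- The component of degree `n` of the operator `T`, that is, `∫ z ^ (-n) U_z T U_z⁻¹ dz`. -/
def opCoeff (hU : IsUnitaryRep U) (T : H →L[ℂ] H) (n : ℤ) : H →L[ℂ] H :=
  LinearMap.mkContinuous
    { toFun := fun v => circleCoeff (fun z => U z (T (U z⁻¹ v))) n
      map_add' := fun v w => by
        rw [← circleCoeff_add (hU.continuous_conj T v) (hU.continuous_conj T w)]
        simp only [map_add]
      map_smul' := fun c v => by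
        rw [RingHom.id_apply, ← circleCoeff_smul]
        simp only [map_smul] } ‖T‖ fun v =>
    norm_circleCoeff_le (f := fun z => U z (T (U z⁻¹ v))) (fun z => by
      rw [hU.norm_map]
      exact (T.le_opNorm _).trans (by rw [hU.norm_map])) n

theorem opCoeff_apply (hU : IsUnitaryRep U) (T : H →L[ℂ] H) (n : ℤ) (v : H) :
    hU.opCoeff T n v = circleCoeff (fun z => U z (T (U z⁻¹ v))) n := rfl

theorem opCoeff_apply_of_fixed (hU : IsUnitaryRep U) (T : H →L[ℂ] H) (n : ℤ) {v : H}
    (hv : ∀ z, U z v = v) : hU.opCoeff T n v = circleCoeff (fun z => U z (T v)) n := by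
  simp only [opCoeff_apply, hv]

variable [CompleteSpace H]

theorem star_eq (hU : IsUnitaryRep U) (z : Circle) : star (U z) = U z⁻¹ := by
  ext v
  refine ext_inner_left ℂ fun w => ?_
  rw [ContinuousLinearMap.star_eq_adjoint, ContinuousLinearMap.adjoint_inner_right,
    ← hU.inner_map_map z w, hU.apply_inv_apply]

theorem circleCoeff_mem_weightSpace (hU : IsUnitaryRep U) (v : H) (n : ℤ) :
    circleCoeff (fun z => U z v) n ∈ weightSpace U n := by
  intro w
  rw [map_circleCoeff (U w) (hU.continuous v), ← circleCoeff_mul_left]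
  simp only [hU.apply_apply]

theorem circleCoeff_of_mem {v : H} {n : ℤ} (hv : v ∈ weightSpace U n) :
    circleCoeff (fun z => U z v) n = v := by
  have h : (fun z => U z v) = fun z : Circle => ((z : ℂ) ^ n) • v := funext hv
  rw [h, circleCoeff_zpow_self]

theorem eq_sum_weights (hU : IsUnitaryRep U) (F : Finset ℤ) (hF : ∀ n ∉ F, weightSpace U n = ⊥)
    (v : H) : v = ∑ n ∈ F, circleCoeff (fun z => U z v) n := by
  have h := eq_sum_circleCoeff (hU.continuous v) F fun n hn => by
    have := hU.circleCoeff_mem_weightSpace v n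
    rwa [hF n hn, Submodule.mem_bot] at this
  rw [← h, hU.map_one]; rfl

/-- `T` shifts each weight `k` in `F` to k + n, where there are no nonzero vectors, and the weight
spaces indexed by `F` span `H`. -/
theorem eq_zero_of_isHomogeneous (hU : IsUnitaryRep U) (F : Finset ℤ)
    (hF : ∀ n ∉ F, weightSpace U n = ⊥) {n : ℤ} (hn : ∀ k ∈ F, k + n ∉ F) {T : H →L[ℂ] H}
    (hT : IsHomogeneous U n T) : T = 0 := by
  ext v
  rw [hU.eq_sum_weights F hF v, map_sum]
  refine Finset.sum_eq_zero fun k hk => ?_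
  have := hT.mem_weightSpace (hU.circleCoeff_mem_weightSpace v k)
  rwa [hF _ (hn k hk), Submodule.mem_bot] at this

theorem isNilpotent_of_isHomogeneous (hU : IsUnitaryRep U) (F : Finset ℤ)
    (hF : ∀ n ∉ F, weightSpace U n = ⊥) {n : ℤ} (hn : n ≠ 0) {T : H →L[ℂ] H}
    (hT : IsHomogeneous U n T) : IsNilpotent T := by
  let S : Finset ℤ := (F ×ˢ F).image fun p => p.1 - p.2
  have hinj : Function.Injective fun k : ℕ => (k : ℤ) * n := fun a b hab => by
    exact_mod_cast mul_right_cancel₀ hn hab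
  -- Weights can only be shifted by elements of the finite set `S` of differences, while the
  -- multiples k n are pairwise distinct; some k n falls outside `S`, and then T ^ k = 0.
  obtain ⟨k, hk⟩ := (S.finite_toSet.preimage hinj.injOn).exists_notMem
  refine ⟨k, hU.eq_zero_of_isHomogeneous F hF (fun j hj hj' => hk ?_) (hT.pow k)⟩
  exact Finset.mem_coe.2 (Finset.mem_image.2
    ⟨(j + k * n, j), Finset.mem_product.2 ⟨hj', hj⟩, by simp⟩)

theorem isHomogeneous_opCoeff (hU : IsUnitaryRep U) (T : H →L[ℂ] H) (n : ℤ) :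
    IsHomogeneous U n (hU.opCoeff T n) := by
  intro w
  ext v
  simp only [mul_apply_eq_comp, smul_apply, opCoeff_apply]
  rw [map_circleCoeff (U w) (hU.continuous_conj T v), ← circleCoeff_mul_left]
  congr 1
  funext z
  rw [hU.apply_apply, hU.apply_apply, mul_inv_rev, inv_mul_cancel_right]

theorem commute_opCoeff (hU : IsUnitaryRep U) {c T : H →L[ℂ] H}
    (h : ∀ z, Commute c (U z * T * U z⁻¹)) (n : ℤ) : Commute c (hU.opCoeff T n) := by
  ext v
  simp only [mul_apply_eq_comp, opCoeff_apply]
  rw [map_circleCoeff c (hU.continuous_conj T v)]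
  congr 1
  funext z
  exact congrArg (fun S : H →L[ℂ] H => S v) (h z).eq

theorem exists_eq_sum_opCoeff (hU : IsUnitaryRep U) (F : Finset ℤ)
    (hF : ∀ n ∉ F, weightSpace U n = ⊥) :
    ∃ S : Finset ℤ, ∀ T : H →L[ℂ] H, T = ∑ n ∈ S, hU.opCoeff T n := by
  -- The differences of weights in `F` are the only possible degrees. The set does not depend on
  -- `T`, so the number of components is uniformly bounded.
  refine ⟨(F ×ˢ F).image fun p => p.1 - p.2, fun T => ?_⟩
  ext v
  have h := eq_sum_circleCoeff (hU.continuous_conj T v) ((F ×ˢ F).image fun p => p.1 - p.2)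
    fun n hn => by
      rw [← hU.opCoeff_apply, hU.eq_zero_of_isHomogeneous F hF (fun k hk hk' => hn ?_)
        (hU.isHomogeneous_opCoeff T n)]
      · rfl
      · exact Finset.mem_image.2 ⟨(k + n, k), Finset.mem_product.2 ⟨hk', hk⟩, by simp⟩
  rw [sum_apply]
  simpa [hU.map_one, opCoeff_apply] using h

end IsUnitaryRep

end CircleRepresentations

/-! ### Commutation of a kernel-preserving operator with the analytic commutant -/

section Commutation

variable {H : Type*} [NormedAddCommGroup H] [InnerProductSpace ℂ H] [CompleteSpace H]

theorem IsHomogeneous.star {U : Circle → H →L[ℂ] H} (hU : IsUnitaryRep U) {n : ℤ}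
    {T : H →L[ℂ] H} (hT : IsHomogeneous U n T) : IsHomogeneous U (-n) (star T) := by
  intro z
  have h := congrArg Star.star (hT z⁻¹)
  rw [star_mul, star_smul, star_mul, hU.star_eq, inv_inv] at h
  have hz : Star.star (((z⁻¹ : Circle) : ℂ) ^ n) = (z : ℂ) ^ n := by
    rw [star_zpow₀, ← starRingEnd_apply, ← Circle.coe_inv_eq_conj, inv_inv]
  rw [h, hz, smul_smul, ← zpow_add₀ (Circle.coe_ne_zero z), neg_add_cancel, zpow_zero, one_smul]

/-- The elements of the commutant of `M` that leave the closed span of the vectors of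
non-negative weight invariant. -/
def analyticCommutant (M : VonNeumannAlgebra H) (U : Circle → H →L[ℂ] H) :
    Subalgebra ℂ (H →L[ℂ] H) where
  carrier := {c | (∀ m ∈ M, Commute m c) ∧ ∀ v ∈ posSpace U, c v ∈ posSpace U}
  mul_mem' ha hb := ⟨fun m hm => (ha.1 m hm).mul_right (hb.1 m hm),
    fun v hv => ha.2 _ (hb.2 v hv)⟩
  add_mem' ha hb := ⟨fun m hm => (ha.1 m hm).add_right (hb.1 m hm),
    fun v hv => (posSpace U).add_mem (ha.2 v hv) (hb.2 v hv)⟩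
  algebraMap_mem' r := ⟨fun m _ => Algebra.commute_algebraMap_right r m, fun v hv => by
    rw [Algebra.algebraMap_eq_smul_one]
    exact (posSpace U).smul_mem r hv⟩

variable {M : VonNeumannAlgebra H} {U : Circle → H →L[ℂ] H}

theorem mem_analyticCommutant {n : ℤ} (hn : 0 ≤ n) {x : H →L[ℂ] H} (hxM : ∀ m ∈ M, Commute m x)
    (hx : IsHomogeneous U n x) : x ∈ analyticCommutant M U :=
  ⟨hxM, fun _ hv => hx.mem_posSpace hn hv⟩

/-- `B` maps the closed span of the vectors of non-negative weight to itself, vanishes on its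
orthogonal complement, and leaves invariant all kernels (inside this subspace) of elements of the
analytic part of the commutant of `M`. -/
structure PreservesKernels (M : VonNeumannAlgebra H) (U : Circle → H →L[ℂ] H)
    [(posSpace U).HasOrthogonalProjection] (B : H →L[ℂ] H) : Prop where
  mapsTo : ∀ v, B v ∈ posSpace U
  comp_proj : B * (posSpace U).starProjection = B
  ker : ∀ c ∈ analyticCommutant M U, ∀ v ∈ posSpace U, c v = 0 → c (B v) = 0

variable [(posSpace U).HasOrthogonalProjection] {B : H →L[ℂ] H}

namespace PreservesKernels

/-- Invariance of the kernels of `p` and of `1 - p` says that `B` respects the decomposition of H₊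
into kernel and range of `p`. -/
theorem commutes_idempotent (hB : PreservesKernels M U B) {p : H →L[ℂ] H}
    (hp : p ∈ analyticCommutant M U) (hpp : IsIdempotentElem p) {v : H} (hv : v ∈ posSpace U) :
    B (p v) = p (B v) := by
  have hpp' : ∀ w, p (p w) = p w := fun w => congrArg (fun S : H →L[ℂ] H => S w) hpp.eq
  have h1 := hB.ker p hp (v - p v) ((posSpace U).sub_mem hv (hp.2 v hv))
    (by rw [map_sub, hpp', sub_self])
  have h2 := hB.ker (1 - p) (Subalgebra.sub_mem _ (Subalgebra.one_mem _) hp) (p v) (hp.2 v hv)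
    (by rw [sub_apply, one_apply_eq_self, hpp', sub_self])
  rw [sub_apply, one_apply_eq_self, sub_eq_zero] at h2
  rw [map_sub, map_sub, sub_eq_zero] at h1
  rw [h1, ← h2]

/-- The graph trick: `q - x` annihilates p v + x v, so it also annihilates B (p v) + B (x v). Moving
`B` past `p` and `q` turns this into the commutation relation. -/
theorem commutes_of_orthogonal (hB : PreservesKernels M U B) {p q x : H →L[ℂ] H}
    (hp : p ∈ analyticCommutant M U) (hq : q ∈ analyticCommutant M U)
    (hx : x ∈ analyticCommutant M U) (hpp : IsIdempotentElem p) (hqq : IsIdempotentElem q)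
    (hpq : p * q = 0) (hqp : q * p = 0) (hqx : q * x = x) (hxp : x * p = x)
    {v : H} (hv : v ∈ posSpace U) : B (x v) = x (B v) := by
  have e1 : ∀ w, p (q w) = 0 := fun w => congrArg (fun S : H →L[ℂ] H => S w) hpq
  have e2 : ∀ w, q (p w) = 0 := fun w => congrArg (fun S : H →L[ℂ] H => S w) hqp
  have e3 : ∀ w, q (x w) = x w := fun w => congrArg (fun S : H →L[ℂ] H => S w) hqx
  have e4 : ∀ w, x (p w) = x w := fun w => congrArg (fun S : H →L[ℂ] H => S w) hxp
  have e5 : ∀ w, x (q w) = 0 := fun w => by rw [← e4, e1, map_zero]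
  have hBp : B (p v) = p (B v) := hB.commutes_idempotent hp hpp hv
  have hBq : B (x v) = q (B (x v)) := by
    rw [← hB.commutes_idempotent hq hqq (hx.2 v hv), e3]
  have h := hB.ker (q - x) (Subalgebra.sub_mem _ hq hx) (p v + x v)
    ((posSpace U).add_mem (hp.2 v hv) (hx.2 v hv)) (by
      rw [sub_apply, map_add, map_add, e2, e3, e4, ← e3 v, e5, e3]; abel)
  rw [map_add, hBp, hBq, sub_apply, map_add, map_add, e2, e4, e5, ← hBq, ← hBq, zero_add,
    add_zero, sub_eq_zero] at h
  exact h

/-- The closed ranges V i of x ^ i decrease to 0, and their projections r i commute with M and have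
degree 0. Since `x` maps V i into V (i + 1), the piece x (r i - r (i + 1)) goes from the range of r
i - r (i + 1) into the orthogonal range of r (i + 1), so the graph trick applies to it; the pieces
add up to `x`. -/
theorem commutes_of_isNilpotent (hB : PreservesKernels M U B) (hU : IsUnitaryRep U) {n : ℤ}
    (hn : 0 ≤ n) {x : H →L[ℂ] H} (hxM : ∀ m ∈ M, Commute m x) (hx : IsHomogeneous U n x)
    (hnil : IsNilpotent x) {v : H} (hv : v ∈ posSpace U) : B (x v) = x (B v) := by
  obtain ⟨L, hL⟩ := hnil
  let V : ℕ → Submodule ℂ H := fun i => (x ^ i).range.topologicalClosure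
  have : ∀ i, CompleteSpace (V i) := fun i =>
    (Submodule.isClosed_topologicalClosure _).completeSpace_coe
  let r : ℕ → H →L[ℂ] H := fun i => (V i).starProjection
  have hxmem : x ∈ analyticCommutant M U := mem_analyticCommutant hn hxM hx
  have hxV : ∀ i, ∀ w ∈ V i, x w ∈ V (i + 1) := by
    intro i
    have h1 : (x ^ i).range ≤ (V (i + 1)).comap (x : H →ₗ[ℂ] H) := by
      rintro _ ⟨w, rfl⟩
      refine Submodule.le_topologicalClosure _ ⟨w, ?_⟩
      rw [pow_succ']
      rfl
    exact Submodule.topologicalClosure_minimal _ h1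
      ((Submodule.isClosed_topologicalClosure _).preimage x.continuous)
  have hmono : ∀ i, V (i + 1) ≤ V i := by
    intro i
    refine Submodule.topologicalClosure_mono ?_
    rintro _ ⟨w, rfl⟩
    refine ⟨x w, ?_⟩
    rw [pow_succ]
    rfl
  have hstab : ∀ i, ∀ c : H →L[ℂ] H, (∀ w, ∃ u, c ((x ^ i) w) = (x ^ i) u) →
      ∀ w ∈ V i, c w ∈ V i := by
    intro i c hc
    have h1 : (x ^ i).range ≤ (V i).comap (c : H →ₗ[ℂ] H) := by
      rintro _ ⟨w, rfl⟩
      obtain ⟨u, hu⟩ := hc w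
      exact Submodule.le_topologicalClosure _ ⟨u, hu.symm⟩
    exact Submodule.topologicalClosure_minimal _ h1
      ((Submodule.isClosed_topologicalClosure _).preimage c.continuous)
  have hrM : ∀ i, ∀ m ∈ M, Commute m (r i) := by
    have key : ∀ i, ∀ m ∈ M, ∀ w ∈ V i, m w ∈ V i := fun i m hm => hstab i m fun w =>
      ⟨m w, congrArg (fun S : H →L[ℂ] H => S w) ((hxM m hm).pow_right i).eq⟩
    exact fun i m hm => commute_starProjection (key i m hm) (key i _ (star_mem hm))
  have hrU : ∀ i, IsHomogeneous U 0 (r i) := by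
    have key : ∀ i z, ∀ w ∈ V i, U z w ∈ V i := fun i z => hstab i (U z) fun w =>
      ⟨((z : ℂ) ^ (i * n)) • U z w, by rw [(hx.pow i).apply, map_smul]⟩
    refine fun i => isHomogeneous_zero_iff.2 fun z => commute_starProjection (key i z) ?_
    rw [hU.star_eq]
    exact key i z⁻¹
  have hr : ∀ i, r i ∈ analyticCommutant M U := fun i =>
    mem_analyticCommutant le_rfl (hrM i) (hrU i)
  have hmem : ∀ i w, r i w ∈ V i := fun i w => Submodule.starProjection_apply_mem _ _
  have hfix : ∀ i, ∀ w ∈ V i, r i w = w := fun i w hw =>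
    Submodule.starProjection_eq_self_iff.2 hw
  have hidem : ∀ i, r i * r i = r i := fun i => by
    ext w
    exact hfix i _ (hmem i w)
  have hr1 : ∀ i, r i * r (i + 1) = r (i + 1) := fun i => by
    ext w
    exact hfix i _ (hmono i (hmem (i + 1) w))
  have hr2 : ∀ i, r (i + 1) * r i = r (i + 1) := fun i => by
    have h := congrArg Star.star (hr1 i)
    rwa [star_mul, (isSelfAdjoint_starProjection (V i)).star_eq,
      (isSelfAdjoint_starProjection (V (i + 1))).star_eq] at h
  have step : ∀ i, ∀ w ∈ posSpace U,
      B ((x * (r i - r (i + 1))) w) = (x * (r i - r (i + 1))) (B w) := by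
    intro i w hw
    have hp : r i - r (i + 1) ∈ analyticCommutant M U := Subalgebra.sub_mem _ (hr i) (hr (i + 1))
    have hpp : (r i - r (i + 1)) * (r i - r (i + 1)) = r i - r (i + 1) := by
      rw [mul_sub, sub_mul, sub_mul, hidem, hidem, hr1, hr2, sub_self, sub_zero]
    refine hB.commutes_of_orthogonal (p := r i - r (i + 1)) (q := r (i + 1)) hp (hr (i + 1))
      (Subalgebra.mul_mem _ hxmem hp) hpp (hidem _) ?_ ?_ ?_ ?_ hw
    · rw [sub_mul, hr1, hidem, sub_self]
    · rw [mul_sub, hr2, hidem, sub_self]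
    · ext u
      refine hfix (i + 1) _ (hxV i _ ?_)
      exact (V i).sub_mem (hmem i u) (hmono i (hmem (i + 1) u))
    · rw [mul_assoc, hpp]
  -- Downward induction on `i`, telescoping from r L = 0 to r 0 = 1.
  have main : ∀ j i, i + j = L → ∀ w ∈ posSpace U, B ((x * r i) w) = (x * r i) (B w) := by
    intro j
    induction j with
    | zero =>
      rintro i rfl w _
      have h0 : r (i + 0) = 0 := by
        ext u
        have hbot : V (i + 0) = ⊥ := by
          change (x ^ (i + 0)).range.topologicalClosure = ⊥
          rw [hL]
          refine le_bot_iff.1 (Submodule.topologicalClosure_minimal _ ?_ isClosed_singleton)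
          rintro _ ⟨w, rfl⟩
          exact Submodule.zero_mem _
        have := hmem (i + 0) u
        rwa [hbot, Submodule.mem_bot] at this
      rw [add_zero] at h0
      rw [h0, mul_zero]
      simp
    | succ j ih =>
      intro i hi w hw
      have h1 := ih (i + 1) (by omega) w hw
      have h2 := step i w hw
      have h3 : x * r i = x * r (i + 1) + x * (r i - r (i + 1)) := by
        rw [← mul_add, add_sub_cancel]
      rw [h3, add_apply, add_apply, map_add, h1, h2]
  have h0 : r 0 = 1 := by
    ext w
    refine hfix 0 w (Submodule.le_topologicalClosure _ ⟨w, ?_⟩)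
    rw [pow_zero]
    rfl
  have := main L 0 (zero_add L) v hv
  rwa [h0, mul_one] at this

theorem commute_of_isSelfAdjoint (hB : PreservesKernels M U B) {y : H →L[ℂ] H}
    (hyM : ∀ m ∈ M, Commute m y) (hyU : IsHomogeneous U 0 y) (hy : IsSelfAdjoint y) :
    Commute B y := by
  refine commute_of_commute_projections hy fun V hV hVc => ?_
  have hVU : IsHomogeneous U 0 V.starProjection :=
    isHomogeneous_zero_iff.2 fun z => hVc _ (isHomogeneous_zero_iff.1 hyU z)
  have hVm : V.starProjection ∈ analyticCommutant M U :=
    mem_analyticCommutant le_rfl (fun m hm => hVc m (hyM m hm)) hVU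
  have hcomm : Commute V.starProjection (posSpace U).starProjection := by
    refine commute_starProjection hVm.2 ?_
    rw [(isSelfAdjoint_starProjection V).star_eq]
    exact hVm.2
  -- Commutation is first known only on H₊. It extends to `H` because `B` vanishes on the complement
  -- of H₊ and the two projections commute.
  have h : B * V.starProjection * (posSpace U).starProjection
      = V.starProjection * B * (posSpace U).starProjection := by
    ext v
    exact hB.commutes_idempotent hVm V.isIdempotentElem_starProjection
      ((posSpace U).starProjection_apply_mem v)
  rwa [mul_assoc, hcomm.eq, ← mul_assoc, hB.comp_proj, mul_assoc, hB.comp_proj] at h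

theorem commute_of_isHomogeneous_zero (hB : PreservesKernels M U B) (hU : IsUnitaryRep U)
    {x : H →L[ℂ] H} (hxM : ∀ m ∈ M, Commute m x) (hxU : IsHomogeneous U 0 x) : Commute B x := by
  have hsM : ∀ m ∈ M, Commute m (star x) := fun m hm => by
    have := (hxM (star m) (star_mem hm)).star_star
    rwa [star_star] at this
  have hsU : ∀ z, Commute (U z) (star x) := isHomogeneous_zero_iff.1 (by simpa using hxU.star hU)
  have hxU' := isHomogeneous_zero_iff.1 hxU
  have h1 : Commute B (x + star x) := hB.commute_of_isSelfAdjoint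
    (fun m hm => (hxM m hm).add_right (hsM m hm))
    (isHomogeneous_zero_iff.2 fun z => (hxU' z).add_right (hsU z)) (IsSelfAdjoint.add_star_self x)
  have h2 : Commute B (Complex.I • (x - star x)) := hB.commute_of_isSelfAdjoint
    (fun m hm => ((hxM m hm).sub_right (hsM m hm)).smul_right _)
    (isHomogeneous_zero_iff.2 fun z => ((hxU' z).sub_right (hsU z)).smul_right _)
    (by rw [isSelfAdjoint_iff, star_smul, star_sub, star_star, Complex.star_def, Complex.conj_I,
          neg_smul, ← smul_neg, neg_sub])
  have h3 := (h1.add_right (h2.smul_right (-Complex.I))).smul_right (2⁻¹ : ℂ)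
  have heq : (2⁻¹ : ℂ) • (x + star x + (-Complex.I) • Complex.I • (x - star x)) = x := by
    rw [smul_smul, neg_mul, Complex.I_mul_I, neg_neg, one_smul]
    have : x + star x + (x - star x) = (2 : ℂ) • x := by rw [two_smul]; abel
    rw [this, smul_smul, inv_mul_cancel₀ two_ne_zero, one_smul]
  rwa [heq] at h3

theorem commutes_of_isHomogeneous (hB : PreservesKernels M U B) (hU : IsUnitaryRep U)
    (F : Finset ℤ) (hF : ∀ n ∉ F, weightSpace U n = ⊥) {n : ℤ} (hn : 0 ≤ n) {x : H →L[ℂ] H}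
    (hxM : ∀ m ∈ M, Commute m x) (hx : IsHomogeneous U n x) {v : H} (hv : v ∈ posSpace U) :
    B (x v) = x (B v) := by
  rcases hn.eq_or_lt with rfl | hn'
  · exact congrArg (fun S : H →L[ℂ] H => S v) (hB.commute_of_isHomogeneous_zero hU hxM hx).eq
  · exact hB.commutes_of_isNilpotent hU hn hxM hx
      (hU.isNilpotent_of_isHomogeneous F hF hn'.ne' hx) hv

/-- On a vector `ξ`, the operator `B` is dominated by any homogeneous element of
the commutant of `M`. -/
theorem norm_apply_le (hB : PreservesKernels M U B) (hU : IsUnitaryRep U) {n : ℤ}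
    {x : H →L[ℂ] H} (hxM : ∀ m ∈ M, Commute m x) (hx : IsHomogeneous U n x) (ξ : H) :
    ‖x (B ξ)‖ ≤ ‖B‖ * ‖x ξ‖ := by
  have hsM : ∀ m ∈ M, Commute m (star x) := fun m hm => by
    have := (hxM (star m) (star_mem hm)).star_star
    rwa [star_star] at this
  have hyU : ∀ z, Commute (U z) (star x * x) := by
    have := (hx.star hU).mul hx
    rw [neg_add_cancel] at this
    exact isHomogeneous_zero_iff.1 this
  set y : H →L[ℂ] H := CFC.sqrt (star x * x) with hy
  have hcomm : ∀ c, Commute c (star x * x) → Commute c y := fun c hc =>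
    (Commute.cfcₙ_nnreal hc.symm _).symm
  have hysa : IsSelfAdjoint y := (CFC.sqrt_nonneg _).isSelfAdjoint
  have hyy : y * y = star x * x := CFC.sqrt_mul_sqrt_self _ (star_mul_self_nonneg x)
  have hnorm : ∀ v, ‖y v‖ = ‖x v‖ := by
    have key : ∀ (T : H →L[ℂ] H) v, ⟪T v, T v⟫_ℂ = ⟪v, (star T * T) v⟫_ℂ := fun T v => by
      rw [mul_apply_eq_comp, ContinuousLinearMap.star_eq_adjoint,
        ContinuousLinearMap.adjoint_inner_right]
    intro v
    have h : ⟪y v, y v⟫_ℂ = ⟪x v, x v⟫_ℂ := by rw [key, key, hysa.star_eq, hyy]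
    rw [inner_self_eq_norm_sq_to_K, inner_self_eq_norm_sq_to_K] at h
    have h' : ‖y v‖ ^ 2 = ‖x v‖ ^ 2 := by exact_mod_cast h
    exact (sq_eq_sq₀ (norm_nonneg _) (norm_nonneg _)).1 h'
  have hBy : B (y ξ) = y (B ξ) := congrArg (fun S : H →L[ℂ] H => S ξ)
    (hB.commute_of_isSelfAdjoint (fun m hm => hcomm m ((hsM m hm).mul_right (hxM m hm)))
      (isHomogeneous_zero_iff.2 fun z => hcomm _ (hyU z)) hysa).eq
  rw [← hnorm, ← hBy, ← hnorm]
  exact B.le_opNorm _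

end PreservesKernels

end Commutation

/-! ### Dense orbits, weight projections and the bicommutant -/

variable {H : Type*} [NormedAddCommGroup H] [InnerProductSpace ℂ H]

namespace IsUnitaryRep

variable {U : Circle → H →L[ℂ] H}

/-- The projection onto the vectors of weight `n`. -/
def weightProj (hU : IsUnitaryRep U) (n : ℤ) : H →L[ℂ] H :=
  LinearMap.mkContinuous
    { toFun := fun v => circleCoeff (fun z => U z v) n
      map_add' := fun v w => by
        rw [← circleCoeff_add (hU.continuous v) (hU.continuous w)]
        simp only [map_add]
      map_smul' := fun c v => by
        rw [RingHom.id_apply, ← circleCoeff_smul]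
        simp only [map_smul] } 1 fun v =>
    norm_circleCoeff_le (f := fun z => U z v) (fun z => by rw [hU.norm_map, one_mul]) n

theorem weightProj_apply (hU : IsUnitaryRep U) (n : ℤ) (v : H) :
    hU.weightProj n v = circleCoeff (fun z => U z v) n := rfl

variable [CompleteSpace H]

/-- The continuous projection onto weight `n` carries the dense set of vectors x ξ to the vectors
x_n ξ, where x_n is the component of `x` of degree `n`, and fixes the vectors of weight `n`. -/
theorem weightSpace_subset_closure (hU : IsUnitaryRep U) {ξ : H} (hξ : ∀ z, U z ξ = ξ)
    {D : Set (H →L[ℂ] H)} (hD : Dense {v | ∃ x ∈ D, x ξ = v}) (n : ℤ) :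
    (weightSpace U n : Set H) ⊆ closure {v | ∃ x ∈ D, hU.opCoeff x n ξ = v} := by
  intro v hv
  have h1 : hU.weightProj n v = v := circleCoeff_of_mem hv
  have h2 := image_closure_subset_closure_image (hU.weightProj n).continuous
    (Set.mem_image_of_mem _ (hD v))
  rw [h1] at h2
  refine closure_mono ?_ h2
  rintro _ ⟨_, ⟨x, hx, rfl⟩, rfl⟩
  exact ⟨x, hx, by rw [hU.opCoeff_apply_of_fixed x n hξ, weightProj_apply]⟩

end IsUnitaryRep

variable [CompleteSpace H]

theorem mem_iff_commute_commutant {M : VonNeumannAlgebra H} {T : H →L[ℂ] H} :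
    T ∈ M ↔ ∀ x ∈ M.commutant, x * T = T * x := by
  conv_lhs => rw [← M.commutant_commutant]
  exact VonNeumannAlgebra.mem_commutant_iff

theorem eq_of_eqOn_orbit {M : VonNeumannAlgebra H} {ξ : H} (hcyc : IsCyclic M ξ)
    {S T : H →L[ℂ] H} (h : ∀ m ∈ M, S (m ξ) = T (m ξ)) : S = T := by
  have : (S : H → H) = T := Continuous.ext_on hcyc S.continuous T.continuous (by
    rintro _ ⟨m, hm, rfl⟩
    exact h m hm)
  exact DFunLike.coe_injective this

/-- A separating vector of `M` is cyclic for the commutant of `M`. -/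
theorem isCyclic_commutant {M : VonNeumannAlgebra H} {ξ : H} (hsep : IsSeparating M ξ) :
    IsCyclic M.commutant ξ := by
  let V : Submodule ℂ H := (LinearMap.range (orbitMap M.commutant ξ)).topologicalClosure
  have : CompleteSpace V := (Submodule.isClosed_topologicalClosure _).completeSpace_coe
  have key : ∀ x ∈ M.commutant, ∀ v ∈ V, x v ∈ V := by
    intro x hx
    have h1 : LinearMap.range (orbitMap M.commutant ξ) ≤ V.comap (x : H →ₗ[ℂ] H) := by
      rintro _ ⟨y, rfl⟩
      exact Submodule.le_topologicalClosure _ ⟨⟨x, hx⟩ * y, rfl⟩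
    exact Submodule.topologicalClosure_minimal _ h1
      ((Submodule.isClosed_topologicalClosure _).preimage x.continuous)
  -- `V` is the closure of M'ξ, so its projection lies in M'' = M. As 1 minus this projection
  -- annihilates ξ, it vanishes.
  have hp : V.starProjection ∈ M := by
    rw [mem_iff_commute_commutant]
    exact fun x hx => (commute_starProjection (key x hx) (key _ (star_mem hx))).eq
  have hξ : V.starProjection ξ = ξ := Submodule.starProjection_eq_self_iff.2
    (Submodule.le_topologicalClosure _ ⟨1, rfl⟩)
  have h1 : 1 - V.starProjection = 0 := hsep _ (sub_mem (one_mem M) hp)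
    (by rw [sub_apply, one_apply_eq_self, hξ, sub_self])
  intro v
  have hv : v ∈ V := by
    have := Submodule.starProjection_apply_mem V v
    rwa [← sub_eq_zero.1 h1] at this
  refine closure_mono ?_ hv
  rintro _ ⟨y, rfl⟩
  exact ⟨y, y.2, rfl⟩

/-! ### The unitary flow, its spectrum, and the passage from B(H₊) back to M -/

section Flow

variable {M : VonNeumannAlgebra H}
  {α : Circle →* (M.toStarSubalgebra ≃⋆ₐ[ℂ] M.toStarSubalgebra)} {ξ : H}

/-- Vector functionals are the ultraweak functionals given by sequences supported at index 0. -/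
theorem IsWStarContinuous.continuous_inner (hα : IsWStarContinuous α) (m : M.toStarSubalgebra)
    (v w : H) : Continuous fun z => ⟪v, (α z m : H →L[ℂ] H) w⟫_ℂ := by
  have h := continuous_induced_rng.1 (hα m)
  have h2 := (continuous_apply
    ((lp.single 2 0 v : lp (fun _ : ℕ => H) 2), (lp.single 2 0 w : lp (fun _ : ℕ => H) 2))).comp h
  refine h2.congr fun z => ?_
  refine (tsum_eq_single 0 fun k hk => ?_).trans ?_
  · rw [lp.single_apply_ne _ _ _ hk, inner_zero_left]
  · simp

/-- The operators `U_z` form a strongly continuous unitary representation. -/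
theorem isUnitaryRep_flowUnitary (hα : IsWStarContinuous α) (hcyc : IsCyclic M ξ)
    (hinv : IsInvariantVectorState α ξ) : IsUnitaryRep (flowUnitary α ξ) := by
  have happ : ∀ z m (hm : m ∈ M), flowUnitary α ξ z (m ξ)
      = (α z ⟨m, hm⟩ : H →L[ℂ] H) ξ := fun z m hm => flowUnitary_apply hcyc hinv z ⟨m, hm⟩
  have hnorm : ∀ z v, ‖flowUnitary α ξ z v‖ = ‖v‖ := by
    intro z v
    refine congrFun (Continuous.ext_on hcyc (f := fun v => ‖flowUnitary α ξ z v‖)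
      (flowUnitary α ξ z).continuous.norm continuous_norm ?_) v
    rintro _ ⟨m, hm, rfl⟩
    change ‖flowUnitary α ξ z (m ξ)‖ = ‖m ξ‖
    rw [happ z m hm]
    exact norm_orbit hinv z ⟨m, hm⟩
  have hone : flowUnitary α ξ 1 = 1 := eq_of_eqOn_orbit hcyc fun m hm => by
    rw [happ 1 m hm, map_one]; rfl
  have hmul : ∀ z w, flowUnitary α ξ (z * w) = flowUnitary α ξ z * flowUnitary α ξ w :=
    fun z w => eq_of_eqOn_orbit hcyc fun m hm => by
      rw [happ _ m hm, mul_apply_eq_comp, happ w m hm, flowUnitary_apply hcyc hinv, map_mul]; rfl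
  have horb : ∀ m ∈ M, Continuous fun z => flowUnitary α ξ z (m ξ) := by
    intro m hm
    have hweak : ∀ v, Continuous fun z => ⟪v, flowUnitary α ξ z (m ξ)⟫_ℂ := fun v =>
      (hα.continuous_inner ⟨m, hm⟩ v ξ).congr fun z => by rw [happ z m hm]
    rw [continuous_iff_continuousAt]
    intro w
    rw [ContinuousAt, tendsto_iff_norm_sub_tendsto_zero]
    -- Weak convergence together with constant norms gives norm convergence, by expanding the
    -- square.
    have h1 : Filter.Tendsto (fun z => ‖flowUnitary α ξ z (m ξ) - flowUnitary α ξ w (m ξ)‖ ^ 2)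
        (nhds w) (nhds 0) := by
      have h2 : ∀ z, ‖flowUnitary α ξ z (m ξ) - flowUnitary α ξ w (m ξ)‖ ^ 2
          = 2 * ‖m ξ‖ ^ 2
            - 2 * RCLike.re ⟪flowUnitary α ξ w (m ξ), flowUnitary α ξ z (m ξ)⟫_ℂ := by
        intro z
        rw [norm_sub_sq (𝕜 := ℂ), hnorm, hnorm, inner_re_symm]
        ring
      simp only [h2]
      have h3 := (((RCLike.continuous_re.comp (hweak (flowUnitary α ξ w (m ξ)))).tendsto
        w).const_mul 2).const_sub (2 * ‖m ξ‖ ^ 2)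
      simp only [Function.comp_apply, inner_self_eq_norm_sq, hnorm, sub_self] at h3
      exact h3
    have h4 := h1.sqrt
    simpa using h4
  refine ⟨hone, hmul, hnorm, fun v => ?_⟩
  rw [continuous_iff_continuousAt]
  intro w
  rw [ContinuousAt, Metric.tendsto_nhds]
  intro ε hε
  obtain ⟨_, hv, m, hm, rfl⟩ := Metric.dense_iff.1 hcyc v (ε / 3) (by positivity)
  filter_upwards [Metric.tendsto_nhds.1 ((horb m hm).tendsto w) (ε / 3) (by positivity)] with z hz
  rw [Metric.mem_ball, dist_comm, dist_eq_norm] at hv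
  rw [dist_eq_norm] at hz ⊢
  have h1 := hnorm z (v - m ξ)
  have h2 := hnorm w (v - m ξ)
  have heq : flowUnitary α ξ z v - flowUnitary α ξ w v
      = flowUnitary α ξ z (v - m ξ) + (flowUnitary α ξ z (m ξ) - flowUnitary α ξ w (m ξ))
        - flowUnitary α ξ w (v - m ξ) := by
    rw [map_sub, map_sub]; abel
  rw [heq]
  refine (norm_sub_le _ _).trans_lt ((add_le_add_left (norm_add_le _ _) _).trans_lt ?_)
  linarith

theorem flowUnitary_fixed (hcyc : IsCyclic M ξ) (hinv : IsInvariantVectorState α ξ) (z : Circle) :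
    flowUnitary α ξ z ξ = ξ := by
  have := flowUnitary_apply hcyc hinv z 1
  rw [map_one] at this
  exact this

theorem flowUnitary_mul (hcyc : IsCyclic M ξ) (hinv : IsInvariantVectorState α ξ) (z : Circle)
    (m : M.toStarSubalgebra) :
    flowUnitary α ξ z * (m : H →L[ℂ] H) = (α z m : H →L[ℂ] H) * flowUnitary α ξ z :=
  eq_of_eqOn_orbit hcyc fun a ha => by
    have h1 := flowUnitary_apply hcyc hinv z (m * ⟨a, ha⟩)
    have h2 := flowUnitary_apply hcyc hinv z ⟨a, ha⟩
    rw [map_mul] at h1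
    rw [mul_apply_eq_comp, mul_apply_eq_comp, h2]
    exact h1

theorem flowUnitary_conj (hU : IsUnitaryRep (flowUnitary α ξ)) (hcyc : IsCyclic M ξ)
    (hinv : IsInvariantVectorState α ξ) (z : Circle) (m : M.toStarSubalgebra) :
    flowUnitary α ξ z * (m : H →L[ℂ] H) * flowUnitary α ξ z⁻¹ = (α z m : H →L[ℂ] H) := by
  rw [flowUnitary_mul hcyc hinv, mul_assoc, ← hU.map_mul, mul_inv_cancel, hU.map_one, mul_one]

theorem isHomogeneous_iff (hU : IsUnitaryRep (flowUnitary α ξ)) (hcyc : IsCyclic M ξ)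
    (hinv : IsInvariantVectorState α ξ) {n : ℤ} {m : M.toStarSubalgebra} :
    IsHomogeneous (flowUnitary α ξ) n (m : H →L[ℂ] H) ↔ m ∈ spectralSubspace α n := by
  constructor
  · intro h z
    refine Subtype.ext ?_
    rw [← flowUnitary_conj hU hcyc hinv, h z, smul_mul_assoc, mul_assoc, ← hU.map_mul,
      mul_inv_cancel, hU.map_one, mul_one]
    rfl
  · intro h z
    rw [flowUnitary_mul hcyc hinv, h z]
    exact smul_mul_assoc _ _ _

theorem opCoeff_mem (hU : IsUnitaryRep (flowUnitary α ξ)) (hcyc : IsCyclic M ξ)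
    (hinv : IsInvariantVectorState α ξ) {m : H →L[ℂ] H} (hm : m ∈ M) (n : ℤ) :
    hU.opCoeff m n ∈ M := by
  rw [mem_iff_commute_commutant]
  refine fun x hx => (hU.commute_opCoeff (fun z => ?_) n).eq
  have h := flowUnitary_conj hU hcyc hinv z ⟨m, hm⟩
  rw [h]
  exact (VonNeumannAlgebra.mem_commutant_iff.1 hx _ (α z ⟨m, hm⟩).2).symm

theorem commute_opCoeff_commutant (hU : IsUnitaryRep (flowUnitary α ξ)) (hcyc : IsCyclic M ξ)
    (hinv : IsInvariantVectorState α ξ) {x : H →L[ℂ] H} (hx : x ∈ M.commutant) (n : ℤ) :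
    ∀ m ∈ M, Commute m (hU.opCoeff x n) := by
  refine fun m hm => hU.commute_opCoeff (fun z => ?_) n
  have h := flowUnitary_conj hU hcyc hinv z (α z⁻¹ ⟨m, hm⟩)
  have h2 : α z (α z⁻¹ ⟨m, hm⟩) = ⟨m, hm⟩ := by
    have : (α z * α z⁻¹) ⟨m, hm⟩ = ⟨m, hm⟩ := by rw [← map_mul, mul_inv_cancel, map_one]; rfl
    exact this
  rw [h2] at h
  set a : H →L[ℂ] H := (α z⁻¹ ⟨m, hm⟩ : H →L[ℂ] H) with ha
  have hax : a * x = x * a := VonNeumannAlgebra.mem_commutant_iff.1 hx _ (α z⁻¹ ⟨m, hm⟩).2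
  have hinv' : flowUnitary α ξ z⁻¹ * flowUnitary α ξ z = 1 := by
    rw [← hU.map_mul, inv_mul_cancel, hU.map_one]
  have e : ∀ S T : H →L[ℂ] H, (flowUnitary α ξ z * S * flowUnitary α ξ z⁻¹)
      * (flowUnitary α ξ z * T * flowUnitary α ξ z⁻¹)
      = flowUnitary α ξ z * (S * T) * flowUnitary α ξ z⁻¹ := fun S T => by
    calc _ = flowUnitary α ξ z * S * (flowUnitary α ξ z⁻¹ * flowUnitary α ξ z) * T
          * flowUnitary α ξ z⁻¹ := by simp only [mul_assoc]
      _ = _ := by rw [hinv', mul_one]; simp only [mul_assoc]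
  change m * _ = _ * m
  have hm' : m = flowUnitary α ξ z * a * flowUnitary α ξ z⁻¹ := h.symm
  rw [hm', e, e, hax]

/-- Only weights in the Arveson spectrum occur. -/
theorem weightSpace_eq_bot (hU : IsUnitaryRep (flowUnitary α ξ)) (hcyc : IsCyclic M ξ)
    (hinv : IsInvariantVectorState α ξ) {n : ℤ} (hn : n ∉ arvesonSpectrum α) :
    weightSpace (flowUnitary α ξ) n = ⊥ := by
  have hbot : spectralSubspace α n = ⊥ := not_not.1 hn
  refine le_bot_iff.1 fun v hv => ?_
  have h := hU.weightSpace_subset_closure (flowUnitary_fixed hcyc hinv) (D := M) hcyc n hv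
  have h0 : {v | ∃ x ∈ (M : Set (H →L[ℂ] H)), hU.opCoeff x n ξ = v} ⊆ {0} := by
    rintro _ ⟨x, hx, rfl⟩
    have hmem := (isHomogeneous_iff hU hcyc hinv (m := ⟨_, opCoeff_mem hU hcyc hinv hx n⟩)).1
      (hU.isHomogeneous_opCoeff x n)
    rw [hbot, Submodule.mem_bot] at hmem
    have hz : hU.opCoeff x n = 0 := congrArg Subtype.val hmem
    rw [hz]
    rfl
  have := closure_minimal h0 isClosed_singleton h
  exact this

theorem mem_analyticJoin {n : ℕ} {m : M.toStarSubalgebra} (hm : m ∈ spectralSubspace α (n : ℤ)) :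
    (m : H →L[ℂ] H) ∈ analyticJoin α :=
  Algebra.mem_sInf.2 fun _ hB => hB.2 n m hm

theorem isWOTClosed_of_inner {A : Set (H →L[ℂ] H)} {ι : Type*} (a b c d : ι → H)
    (hA : ∀ T, T ∈ A ↔ ∀ i, ⟪a i, T (b i)⟫_ℂ = ⟪c i, T (d i)⟫_ℂ) : IsWOTClosed A := by
  have h : (fun T : H →WOT[ℂ] H => T.toCLM) ⁻¹' A
      = ⋂ i, {T : H →WOT[ℂ] H | ⟪a i, T (b i)⟫_ℂ = ⟪c i, T (d i)⟫_ℂ} := by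
    ext T
    simp only [Set.mem_preimage, hA, Set.mem_iInter]
    rfl
  rw [IsWOTClosed, h]
  exact isClosed_iInter fun i => isClosed_eq
    (ContinuousLinearMapWOT.continuous_inner_apply continuous_id _ _)
    (ContinuousLinearMapWOT.continuous_inner_apply continuous_id _ _)

/-- Both M and the stabilizer of H₊ are weak-operator closed algebras containing the generators. In
particular, compressing an element of the join to H₊ is merely restricting it. -/
theorem analyticJoin_le (hU : IsUnitaryRep (flowUnitary α ξ)) (hcyc : IsCyclic M ξ)
    (hinv : IsInvariantVectorState α ξ) {a : H →L[ℂ] H} (ha : a ∈ analyticJoin α) :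
    a ∈ M ∧ ∀ v ∈ hardySpace α ξ, a v ∈ hardySpace α ξ := by
  let S : Subalgebra ℂ (H →L[ℂ] H) :=
    { carrier := {a | ∀ v ∈ hardySpace α ξ, a v ∈ hardySpace α ξ}
      mul_mem' := fun ha hb v hv => ha _ (hb v hv)
      add_mem' := fun ha hb v hv => (hardySpace α ξ).add_mem (ha v hv) (hb v hv)
      algebraMap_mem' := fun r v hv => by
        rw [Algebra.algebraMap_eq_smul_one]
        exact (hardySpace α ξ).smul_mem r hv }
  have hS : IsWOTClosed (S : Set (H →L[ℂ] H)) := by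
    refine isWOTClosed_of_inner (ι := (hardySpace α ξ)ᗮ × hardySpace α ξ)
      (fun p => p.1) (fun p => p.2) (fun _ => 0) (fun _ => 0) fun T => ?_
    constructor
    · intro hT p
      rw [map_zero, inner_zero_right]
      exact Submodule.inner_left_of_mem_orthogonal (hT _ p.2.2) p.1.2
    · intro hT v hv
      rw [← (hardySpace α ξ).orthogonal_orthogonal, Submodule.mem_orthogonal]
      intro u hu
      simpa using hT (⟨u, hu⟩, ⟨v, hv⟩)
  have hM : IsWOTClosed ((M.toStarSubalgebra.toSubalgebra : Subalgebra ℂ (H →L[ℂ] H)) :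
      Set (H →L[ℂ] H)) := by
    refine isWOTClosed_of_inner (ι := M.commutant × H × H)
      (fun p => star (p.1 : H →L[ℂ] H) p.2.1) (fun p => p.2.2) (fun p => p.2.1)
      (fun p => (p.1 : H →L[ℂ] H) p.2.2) fun T => ?_
    have h1 : T ∈ (M.toStarSubalgebra.toSubalgebra : Set (H →L[ℂ] H)) ↔ T ∈ M := Iff.rfl
    rw [h1, mem_iff_commute_commutant]
    constructor
    · rintro h ⟨x, u, v⟩
      have := congrArg (fun S : H →L[ℂ] H => ⟪u, S v⟫_ℂ) (h x x.2)
      simpa [ContinuousLinearMap.star_eq_adjoint, ContinuousLinearMap.adjoint_inner_left] using this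
    · intro h x hx
      ext v
      refine ext_inner_left ℂ fun u => ?_
      have := h (⟨x, hx⟩, u, v)
      simpa [ContinuousLinearMap.star_eq_adjoint, ContinuousLinearMap.adjoint_inner_left] using this
  have h1 := Algebra.mem_sInf.1 ha M.toStarSubalgebra.toSubalgebra ⟨hM, fun n m _ => m.2⟩
  have h2 := Algebra.mem_sInf.1 ha S ⟨hS, fun n m hm v hv =>
    ((isHomogeneous_iff hU hcyc hinv).2 hm).mem_posSpace (Int.natCast_nonneg n) hv⟩
  exact ⟨h1, h2⟩

/-- The extension by zero of an operator on the Hardy space. -/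
def extendByZero (b : hardySpace α ξ →L[ℂ] hardySpace α ξ) : H →L[ℂ] H :=
  (hardySpace α ξ).subtypeL ∘L b ∘L (hardySpace α ξ).orthogonalProjectionOnto

theorem extendByZero_apply (b : hardySpace α ξ →L[ℂ] hardySpace α ξ) (v : hardySpace α ξ) :
    extendByZero b (v : H) = b v := by
  simp [extendByZero]

instance : (posSpace (flowUnitary α ξ)).HasOrthogonalProjection :=
  inferInstanceAs (hardySpace α ξ).HasOrthogonalProjection

theorem preservesKernels_extendByZero (hU : IsUnitaryRep (flowUnitary α ξ))
    (hcyc : IsCyclic M ξ) (hinv : IsInvariantVectorState α ξ)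
    {b : hardySpace α ξ →L[ℂ] hardySpace α ξ} (hb : b ∈ algLat (analyticAlgebra α ξ)) :
    PreservesKernels M (flowUnitary α ξ) (extendByZero b) where
  mapsTo v := (b ((hardySpace α ξ).orthogonalProjectionOnto v)).2
  comp_proj := by
    ext v
    change ((b ((hardySpace α ξ).orthogonalProjectionOnto ((hardySpace α ξ).starProjection v)) :
      hardySpace α ξ) : H) = b ((hardySpace α ξ).orthogonalProjectionOnto v)
    rw [Submodule.starProjection_apply, Submodule.orthogonalProjectionOnto_mem_subspace_eq_self]
  ker c hc v hv hcv := by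
    -- The test subspace is the kernel of `c` in H₊; it is invariant because M₊ acts by restrictions
    -- of elements of M, which commute with `c`.
    have hK := hb (c ∘L (hardySpace α ξ).subtypeL).ker
      ⟨(c ∘L (hardySpace α ξ).subtypeL).isClosed_ker, ?_⟩ ⟨v, hv⟩ hcv
    · rw [show extendByZero b v = b ⟨v, hv⟩ from extendByZero_apply b ⟨v, hv⟩]
      exact hK
    · rintro _ ⟨a, ha, rfl⟩ x hx
      obtain ⟨haM, haH⟩ := analyticJoin_le hU hcyc hinv ha
      have hx' : c (x : H) = 0 := hx
      change c ((hardySpace α ξ).orthogonalProjectionOnto (a (x : H)) : H) = 0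
      have h1 : ((hardySpace α ξ).orthogonalProjectionOnto (a (x : H)) : H) = a (x : H) :=
        Submodule.starProjection_eq_self_iff.2 (haH _ x.2)
      have h2 : a (c (x : H)) = c (a (x : H)) :=
        congrArg (fun S : H →L[ℂ] H => S (x : H)) (hc.1 a haM).eq
      rw [h1, ← h2, hx', map_zero]

end Flow

/-- If `B` preserves kernels, then it agrees on the Hardy space with an element of `M`. -/
theorem exists_mem_eqOn {M : VonNeumannAlgebra H}
    {α : Circle →* (M.toStarSubalgebra ≃⋆ₐ[ℂ] M.toStarSubalgebra)} {ξ : H}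
    (hU : IsUnitaryRep (flowUnitary α ξ)) (hcyc : IsCyclic M ξ) (hsep : IsSeparating M ξ)
    (hinv : IsInvariantVectorState α ξ) (hsp : (arvesonSpectrum α).Finite)
    {B : H →L[ℂ] H} (hB : PreservesKernels M (flowUnitary α ξ) B) :
    ∃ a ∈ M, ∀ v ∈ hardySpace α ξ, a v = B v := by
  have hF : ∀ n ∉ hsp.toFinset, weightSpace (flowUnitary α ξ) n = ⊥ := fun n hn =>
    weightSpace_eq_bot hU hcyc hinv fun h => hn (hsp.mem_toFinset.2 h)
  obtain ⟨S, hS⟩ := hU.exists_eq_sum_opCoeff _ hF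
  have hfix := flowUnitary_fixed hcyc hinv
  have hξ : ξ ∈ weightSpace (flowUnitary α ξ) 0 := fun z => by
    rw [hfix, zpow_zero, one_smul]
  have hcyc' := isCyclic_commutant hsep
  have hd : DenseRange (orbitMap M.commutant ξ) := hcyc'.mono (by
    rintro _ ⟨x, hx, rfl⟩
    exact ⟨⟨x, hx⟩, rfl⟩)
  have hle : ∀ x ∈ M.commutant, ∀ n, ‖hU.opCoeff x n ξ‖ ≤ ‖x ξ‖ := fun x _ n => by
    rw [hU.opCoeff_apply_of_fixed x n hfix]
    exact norm_circleCoeff_le (fun z => (hU.norm_map z _).le) n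
  -- Splitting `x` into its components and applying `norm_apply_le` to each costs only the number of
  -- possible degrees, which is independent of `x`.
  have hbound : ∀ x : M.commutant.toStarSubalgebra,
      ‖orbitMap M.commutant (B ξ) x‖ ≤ (S.card * ‖B‖) * ‖orbitMap M.commutant ξ x‖ := by
    rintro ⟨x, hx⟩
    change ‖x (B ξ)‖ ≤ (S.card * ‖B‖) * ‖x ξ‖
    have h1 : x (B ξ) = ∑ n ∈ S, hU.opCoeff x n (B ξ) := by
      conv_lhs => rw [hS x]
      rw [sum_apply]
    rw [h1]
    refine (norm_sum_le _ _).trans ((Finset.sum_le_card_nsmul _ _ (‖B‖ * ‖x ξ‖) fun n _ => ?_).trans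
      (by rw [nsmul_eq_mul, mul_assoc]))
    refine (hB.norm_apply_le hU (commute_opCoeff_commutant hU hcyc hinv hx n)
      (hU.isHomogeneous_opCoeff x n) ξ).trans ?_
    gcongr
    exact hle x hx n
  let a : H →L[ℂ] H := (orbitMap M.commutant (B ξ)).extendOfNorm (orbitMap M.commutant ξ)
  have ha : ∀ x ∈ M.commutant, a (x ξ) = x (B ξ) := fun x hx =>
    LinearMap.extendOfNorm_eq (f := orbitMap M.commutant (B ξ)) hd ⟨_, hbound⟩ ⟨x, hx⟩
  refine ⟨a, ?_, ?_⟩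
  · rw [mem_iff_commute_commutant]
    refine fun x hx => eq_of_eqOn_orbit hcyc' fun y hy => ?_
    have := ha (x * y) (mul_mem hx hy)
    rw [mul_apply_eq_comp, mul_apply_eq_comp, ha y hy]
    exact this.symm
  -- For `x` in M' homogeneous of degree n ≥ 0, a x ξ = x B ξ = B x ξ; such vectors x ξ are dense in
  -- H_n.
  · have hpos : ∀ n : ℕ, hardyComponent α ξ n
        ≤ LinearMap.eqLocus (a : H →ₗ[ℂ] H) (B : H →ₗ[ℂ] H) := by
      intro n v hv
      have h := hU.weightSpace_subset_closure hfix (D := M.commutant) hcyc' n hv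
      have hcl : IsClosed {v | a v = B v} := isClosed_eq a.continuous B.continuous
      refine closure_minimal ?_ hcl h
      rintro _ ⟨x, hx, rfl⟩
      have hc := commute_opCoeff_commutant hU hcyc hinv hx (n : ℤ)
      change a (hU.opCoeff x n ξ) = B (hU.opCoeff x n ξ)
      rw [ha _ (VonNeumannAlgebra.mem_commutant_iff.2 fun m hm => (hc m hm).eq)]
      exact (hB.commutes_of_isHomogeneous hU _ hF (Int.natCast_nonneg n) hc
        (hU.isHomogeneous_opCoeff x n) (weightSpace_le_posSpace le_rfl hξ)).symm
    exact fun v hv => Submodule.topologicalClosure_minimal _ (iSup_le hpos)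
      (isClosed_eq a.continuous B.continuous) hv

/-- An element of `M` that maps the cyclic vector into the Hardy space is analytic. -/
theorem mem_analyticJoin_of_apply_mem {M : VonNeumannAlgebra H}
    {α : Circle →* (M.toStarSubalgebra ≃⋆ₐ[ℂ] M.toStarSubalgebra)} {ξ : H}
    (hU : IsUnitaryRep (flowUnitary α ξ)) (hcyc : IsCyclic M ξ) (hsep : IsSeparating M ξ)
    (hinv : IsInvariantVectorState α ξ) (hsp : (arvesonSpectrum α).Finite)
    {a : H →L[ℂ] H} (ha : a ∈ M) (haξ : a ξ ∈ hardySpace α ξ) : a ∈ analyticJoin α := by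
  have hF : ∀ n ∉ hsp.toFinset, weightSpace (flowUnitary α ξ) n = ⊥ := fun n hn =>
    weightSpace_eq_bot hU hcyc hinv fun h => hn (hsp.mem_toFinset.2 h)
  obtain ⟨S, hS⟩ := hU.exists_eq_sum_opCoeff _ hF
  rw [hS a]
  refine Subalgebra.sum_mem _ fun n _ => ?_
  have hmem := opCoeff_mem hU hcyc hinv ha n
  rcases lt_or_ge n 0 with hn | hn
  -- This vector is the weight `n` part of a ξ. It stays in H₊ because H₊ is closed and invariant
  -- under the flow, yet H₊ has no nonzero vectors of negative weight.
  · have h0 : hU.opCoeff a n ξ = 0 := by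
      rw [hU.opCoeff_apply_of_fixed a n (flowUnitary_fixed hcyc hinv)]
      exact hU.eq_zero_of_mem_posSpace hn (hU.circleCoeff_mem_weightSpace _ n)
        (circleCoeff_mem isClosed_posSpace (hU.continuous _)
          (fun z => (hU.isHomogeneous_zero z).mem_posSpace le_rfl haξ) n)
    rw [hsep _ hmem h0]
    exact Subalgebra.zero_mem _
  · obtain ⟨k, rfl⟩ := Int.eq_ofNat_of_zero_le hn
    exact mem_analyticJoin (m := ⟨_, hmem⟩)
      ((isHomogeneous_iff hU hcyc hinv).1 (hU.isHomogeneous_opCoeff a k))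

end PeriodicFlow
end

theorem theorem5 {H : Type*} [NormedAddCommGroup H] [InnerProductSpace ℂ H] [CompleteSpace H]
    (M : VonNeumannAlgebra H)
    (α : Circle →* (M.toStarSubalgebra ≃⋆ₐ[ℂ] M.toStarSubalgebra))
    (hα : PeriodicFlow.IsWStarContinuous α)
    (ξ₀ : H) (hnorm : ‖ξ₀‖ = 1)
    (hcyc : PeriodicFlow.IsCyclic M ξ₀) (hsep : PeriodicFlow.IsSeparating M ξ₀)
    (hinv : PeriodicFlow.IsInvariantVectorState α ξ₀)
    (hsp : (PeriodicFlow.arvesonSpectrum α).Finite) :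
    PeriodicFlow.IsReflexive (PeriodicFlow.analyticAlgebra α ξ₀) := by
  open PeriodicFlow in
  have hU := isUnitaryRep_flowUnitary hα hcyc hinv
  refine Set.Subset.antisymm (fun a ha K hK x hx => hK.2 a ha x hx) fun b hb => ?_
  obtain ⟨a, haM, hab⟩ := exists_mem_eqOn hU hcyc hsep hinv hsp
    (preservesKernels_extendByZero hU hcyc hinv hb)
  have hab' : ∀ v : hardySpace α ξ₀, a v = b v := fun v => by
    rw [hab v v.2, extendByZero_apply]
  have hξ : ξ₀ ∈ hardySpace α ξ₀ := weightSpace_le_posSpace (n := 0) le_rfl fun z => by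
    rw [flowUnitary_fixed hcyc hinv, zpow_zero, one_smul]
  refine ⟨a, mem_analyticJoin_of_apply_mem hU hcyc hsep hinv hsp haM ?_, ?_⟩
  · rw [hab' ⟨ξ₀, hξ⟩]
    exact (b ⟨ξ₀, hξ⟩).2
  · ext v
    change ((hardySpace α ξ₀).orthogonalProjectionOnto (a (v : H)) : H) = b v
    rw [hab', Submodule.orthogonalProjectionOnto_mem_subspace_eq_self]
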